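/- For a positive integer $m$ and $q\in\mathbb{C}$ with $|q|<1$ let $f_m=\prod_{n=1}^{\infty}(1-q^{mn})$, and let the integers $M(n)$, $T^\ast(n)$, $P^\ast(n)$ ($n\ge 0$) be defined by $$\sum_{n=0}^{\infty}M(n)q^n=\frac{f_2^5f_5^5}{f_1f_{10}},\qquad \sum_{n=0}^{\infty}T^\ast(n)q^n=\frac{f_1^5f_{10}^5}{f_2f_5},\qquad \sum_{n=0}^{\infty}P^\ast(n)q^n=f_1^4f_5^4 .$$ Define integer sequences by $A_0=A_1=1$, $B_0=0$, $B_1=1$, $C_0=1$, $C_1=-4$ and, for $k\ge 2$, $$P_k=-4P_{k-1}-8P_{k-2}+5\cdot 2^{k-1}\quad\text{for } P\in\{A,B\},\qquad C_k=-4C_{k-1}-8C_{k-2}.$$ Then for every integer $k\ge 1$ and every $q\in\mathbb{C}$ with $0<|q|<1$ (the series on the left converging absolutely), $$\sum_{n=-1}^{\infty}M(2^kn+2^{k+1}-1)q^n=A_k\frac{f_1^4f_5^4}{q}-8A_{k-1}f_2^4f_{10}^4+5\cdot 2^kf_1f_2f_5^3f_{10}^3,$$ $$\sum_{n=-1}^{\infty}T^\ast(2^kn+2^{k+1}-2)q^n=B_k\frac{f_1^4f_5^4}{q}-8B_{k-1}f_2^4f_{10}^4+5\cdot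 2^kf_1f_2f_5^3f_{10}^3,$$ $$\sum_{n=-1}^{\infty}P^\ast(2^kn+2^{k+1}-1)q^n=C_k\frac{f_1^4f_5^4}{q}-8C_{k-1}f_2^4f_{10}^4.$$ -/

import Mathlib

open scoped PowerSeries.WithPiTopology

/-- The infinite product `f_m = ∏_{n ≥ 1} (1 - x ^ (m n))`, in any topological commutative ring.
It is used for a complex number `x = q` with `|q| < 1`, and for the variable `x = X` of the ring
`ℤ⟦X⟧` of formal power series (with coefficientwise convergence, `ℤ` being discrete). -/
noncomputable def eulerF {R : Type*} [CommRing R] [TopologicalSpace R] (m : ℕ) (x : R) : R :=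
  ∏' n : ℕ, (1 - x ^ (m * (n + 1)))

/-- The formal power series `f_m ∈ ℤ⟦X⟧`. -/
noncomputable def formalF (m : ℕ) : PowerSeries ℤ := eulerF m (PowerSeries.X : PowerSeries ℤ)

/-- The formal power series `f_2 ^ 5 f_5 ^ 5 / (f_1 f_10)`; the denominator has constant
coefficient `1` and is therefore invertible. -/
noncomputable def genM : PowerSeries ℤ :=
  formalF 2 ^ 5 * formalF 5 ^ 5 * PowerSeries.invOfUnit (formalF 1 * formalF 10) 1

/-- The formal power series `f_1 ^ 5 f_10 ^ 5 / (f_2 f_5)`. -/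
noncomputable def genTstar : PowerSeries ℤ :=
  formalF 1 ^ 5 * formalF 10 ^ 5 * PowerSeries.invOfUnit (formalF 2 * formalF 5) 1

/-- The formal power series `f_1 ^ 4 f_5 ^ 4`. -/
noncomputable def genPstar : PowerSeries ℤ := formalF 1 ^ 4 * formalF 5 ^ 4

/-- `M(n)`, the coefficient of `q ^ n` in `f_2 ^ 5 f_5 ^ 5 / (f_1 f_10)`. -/
noncomputable def partM (n : ℕ) : ℤ := PowerSeries.coeff n genM

/-- `T*(n)`, the coefficient of `q ^ n` in `f_1 ^ 5 f_10 ^ 5 / (f_2 f_5)`. -/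
noncomputable def partTstar (n : ℕ) : ℤ := PowerSeries.coeff n genTstar

/-- `P*(n)`, the coefficient of `q ^ n` in `f_1 ^ 4 f_5 ^ 4`. -/
noncomputable def partPstar (n : ℕ) : ℤ := PowerSeries.coeff n genPstar

/-- `A_0 = A_1 = 1` and `A_k = -4 A_{k-1} - 8 A_{k-2} + 5 * 2 ^ (k-1)` for `k ≥ 2`. -/
def seqA : ℕ → ℤ
  | 0 => 1
  | 1 => 1
  | k + 2 => -4 * seqA (k + 1) - 8 * seqA k + 5 * 2 ^ (k + 1)

/-- `B_0 = 0`, `B_1 = 1` and `B_k = -4 B_{k-1} - 8 B_{k-2} + 5 * 2 ^ (k-1)` for `k ≥ 2`. -/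
def seqB : ℕ → ℤ
  | 0 => 0
  | 1 => 1
  | k + 2 => -4 * seqB (k + 1) - 8 * seqB k + 5 * 2 ^ (k + 1)

/-- `C_0 = 1`, `C_1 = -4` and `C_k = -4 C_{k-1} - 8 C_{k-2}` for `k ≥ 2`. -/
def seqC : ℕ → ℤ
  | 0 => 1
  | 1 => -4
  | k + 2 => -4 * seqC (k + 1) - 8 * seqC k

/-- The product defining the formal series `f_m` converges for `m ≥ 1`. -/
theorem formalF_multipliable (m : ℕ) (hm : 1 ≤ m) :
    Multipliable fun n : ℕ => (1 - PowerSeries.X ^ (m * (n + 1)) : PowerSeries ℤ) := by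
  simp_rw [sub_eq_add_neg]
  apply PowerSeries.WithPiTopology.multipliable_one_add_of_tendsto_order_atTop_nhds_top
  refine ENat.tendsto_nhds_top_iff_natCast_lt.mpr fun n => Filter.eventually_atTop.mpr ⟨n, ?_⟩
  intro b hb
  rw [PowerSeries.order_neg, PowerSeries.order_X_pow, Nat.cast_lt]
  nlinarith

/-- The formal series `f_m` has constant coefficient `1` for `m ≥ 1`. -/
theorem constantCoeff_formalF (m : ℕ) (hm : 1 ≤ m) :
    PowerSeries.constantCoeff (formalF m) = 1 := by
  have hm' : m ≠ 0 := by omega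
  unfold formalF eulerF
  rw [(formalF_multipliable m hm).map_tprod _
    (PowerSeries.WithPiTopology.continuous_constantCoeff ℤ)]
  simp [hm']

/-- `genM` is the quotient `f_2 ^ 5 f_5 ^ 5 / (f_1 f_10)`. -/
theorem genM_mul : genM * (formalF 1 * formalF 10) = formalF 2 ^ 5 * formalF 5 ^ 5 := by
  rw [genM, mul_assoc, PowerSeries.invOfUnit_mul, mul_one]
  simp [constantCoeff_formalF]

/-- `genTstar` is the quotient `f_1 ^ 5 f_10 ^ 5 / (f_2 f_5)`. -/
theorem genTstar_mul : genTstar * (formalF 2 * formalF 5) = formalF 1 ^ 5 * formalF 10 ^ 5 := by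
  rw [genTstar, mul_assoc, PowerSeries.invOfUnit_mul, mul_one]
  simp [constantCoeff_formalF]

/-!
Write `F = q f₁⁴ f₅⁴`, `G(q) = F(q²)` and `H = q² f₁ f₂ f₅³ f₁₀³`, and let `U₂` be the operator
`∑ a(n) qⁿ ↦ ∑ a(2n) qⁿ`. After multiplication by `q²`, the left sides of the theorem are
the images under `U₂ᵏ` of `q ∑ M(n) qⁿ`, `q² ∑ T*(n) qⁿ` and `q ∑ P*(n) qⁿ = F`. Everything
follows by induction on `k` from
`U₂ F = -4 F - 8 G`, `U₂ G = F`, `U₂ H = F + 2 H`, `U₂ (q ∑ M(n) qⁿ) = F - 8 G + 10 H` and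
`U₂ (q² ∑ T*(n) qⁿ) = F + 10 H`.

On functions, `U₂` is given by `2 (U₂ f)(q²) = f(q) + f(-q)`, so these are identities between
Euler products at `q`, `-q` and `q²`. The Hauptmodul `t = f₁³ f₅ / (q f₂ f₁₀³)` of level ten is such
that `t + 4` and `t + 5` are again products of Euler products (`hauptmodul_add_four`,
`hauptmodul_add_five`). Hence, with `T = t(q²)`, the products of `t`, `t + 4` at `q` and `-q` are
rational in `T`, and so is `t(q) + t(-q)`: the numbers `t(q)` and `t(-q)` are the roots of an
explicit quadratic over `ℚ(T)`. Each of the forms above is `G` times a rational function of `t` and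
`T`, and the identities become identities between symmetric functions of the two roots.

The two formulas for `t + 4` and `t + 5` are equivalent to
`φ(-q⁵)² - φ(-q)² = 4 q f₁ f₁₀³ / (f₂ f₅)` and `ψ(q)² - q ψ(q⁵)² = f₂ f₅³ / (f₁ f₁₀)`
(`eulerF_phi_identity`, `eulerF_psi_identity`). In both, the square of a theta series is a
sum over `ℤ²`, which is split over the five cosets of the sublattice `{(m + 2n, 2m - n)}`
(`thetaSeries_one_sq`); the resulting theta series are turned into products by the Jacobi triple
product (`tsum_zpow_sq_mul_zpow`), which is the limit of its finite form.

The coefficients in the theorem are those of formal power series, while the identities hold between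
complex functions. The link is that the formal series converge on the unit disc to the
corresponding functions: for `f_m` by dominated convergence from the finite products
(`sumsOnDisc_formalF`), for quotients by uniqueness of Taylor coefficients (`SumsOnDisc.div`).
-/

open Filter Topology

/-! ### Euler products at a point of the unit disc -/

/-- A geometric progression of exponents `a n + b` with `a ≥ 1` is absolutely summable. -/
theorem summable_norm_pow_mul_add {q : ℂ} (hq : ‖q‖ < 1) {a : ℕ} (ha : a ≠ 0) (b : ℕ) :
    Summable fun n : ℕ => ‖q ^ (a * n + b)‖ := by
  have h : ‖q‖ ^ a < 1 := pow_lt_one₀ (norm_nonneg _) hq ha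
  have := (summable_geometric_of_lt_one (by positivity) h).mul_right (‖q‖ ^ b)
  simpa [norm_pow, pow_add, pow_mul] using this

theorem multipliable_one_add_pow {q : ℂ} (hq : ‖q‖ < 1) {a : ℕ} (ha : a ≠ 0) (b : ℕ) :
    Multipliable fun n : ℕ => 1 + q ^ (a * n + b) :=
  multipliable_one_add_of_summable (summable_norm_pow_mul_add hq ha b)

theorem multipliable_one_sub_pow {q : ℂ} (hq : ‖q‖ < 1) {a : ℕ} (ha : a ≠ 0) (b : ℕ) :
    Multipliable fun n : ℕ => 1 - q ^ (a * n + b) := by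
  simp_rw [sub_eq_add_neg]
  exact multipliable_one_add_of_summable (by simpa using summable_norm_pow_mul_add hq ha b)

theorem one_sub_ne_zero_of_norm_lt {z : ℂ} (hz : ‖z‖ < 1) : 1 - z ≠ 0 := by
  intro h
  rw [← sub_eq_zero.mp h] at hz
  simp at hz

theorem norm_pow_lt_one {q : ℂ} (hq : ‖q‖ < 1) {m : ℕ} (hm : m ≠ 0) : ‖q ^ m‖ < 1 := by
  rw [norm_pow]
  exact pow_lt_one₀ (norm_nonneg _) hq hm

/-- The product `∏ (1 - q ^ (a n + b))`, `n ≥ 0`. -/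
noncomputable def progProd (a b : ℕ) (q : ℂ) : ℂ := ∏' n : ℕ, (1 - q ^ (a * n + b))

/-- The product `∏ (1 + q ^ (a n + b))`, `n ≥ 0`. -/
noncomputable def progProdAdd (a b : ℕ) (q : ℂ) : ℂ := ∏' n : ℕ, (1 + q ^ (a * n + b))

theorem progProd_ne_zero {q : ℂ} (hq : ‖q‖ < 1) {a b : ℕ} (ha : a ≠ 0) (hb : b ≠ 0) :
    progProd a b q ≠ 0 := by
  unfold progProd
  simp_rw [sub_eq_add_neg]
  refine tprod_one_add_ne_zero_of_summable (fun n => ?_)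
    (by simpa using summable_norm_pow_mul_add hq ha b)
  rw [← sub_eq_add_neg]
  exact one_sub_ne_zero_of_norm_lt (norm_pow_lt_one hq (by omega))

theorem eulerF_eq_progProd (m : ℕ) (q : ℂ) : eulerF m q = progProd m m q := by
  simp [eulerF, progProd, mul_add]

theorem eulerF_ne_zero {q : ℂ} (hq : ‖q‖ < 1) {m : ℕ} (hm : m ≠ 0) : eulerF m q ≠ 0 := by
  rw [eulerF_eq_progProd]
  exact progProd_ne_zero hq hm hm

theorem eulerF_pow (m k : ℕ) (q : ℂ) : eulerF m (q ^ k) = eulerF (k * m) q := by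
  simp [eulerF, ← pow_mul, mul_assoc]

/-- An infinite product over `ℕ` splits into the products over the residue classes modulo `N`. -/
theorem tprod_residueClasses {g : ℕ → ℂ} (N : ℕ) (hN : N ≠ 0) (hg : Multipliable g)
    (hgj : ∀ j < N, Multipliable fun n => g (N * n + j)) :
    ∏' n, g n = ∏ j ∈ Finset.range N, ∏' n, g (N * n + j) := by
  have key : ∀ K, ∏ i ∈ Finset.range (N * K), g i =
      ∏ j ∈ Finset.range N, ∏ n ∈ Finset.range K, g (N * n + j) := by
    intro K
    induction K with
    | zero => simp
    | succ K ih =>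
      simp_rw [Finset.prod_range_succ, Finset.prod_mul_distrib]
      rw [mul_add_one, Finset.prod_range_add, ih]
  have h1 : Tendsto (fun K => ∏ i ∈ Finset.range (N * K), g i) atTop (𝓝 (∏' n, g n)) :=
    hg.tendsto_prod_tprod_nat.comp
      (tendsto_id.const_mul_atTop' (Nat.pos_of_ne_zero hN))
  have h2 : Tendsto (fun K => ∏ j ∈ Finset.range N, ∏ n ∈ Finset.range K, g (N * n + j)) atTop
      (𝓝 (∏ j ∈ Finset.range N, ∏' n, g (N * n + j))) :=
    tendsto_finsetProd _ fun j hj => (hgj j (Finset.mem_range.mp hj)).tendsto_prod_tprod_nat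
  simp_rw [key] at h1
  exact tendsto_nhds_unique h1 h2

theorem progProd_split {q : ℂ} (hq : ‖q‖ < 1) {a : ℕ} (ha : a ≠ 0) (b : ℕ) (N : ℕ) (hN : N ≠ 0) :
    progProd a b q = ∏ j ∈ Finset.range N, progProd (N * a) (a * j + b) q := by
  unfold progProd
  rw [tprod_residueClasses N hN (multipliable_one_sub_pow hq ha b)]
  · refine Finset.prod_congr rfl fun j _ => tprod_congr fun n => ?_
    ring_nf
  · intro j _
    convert multipliable_one_sub_pow hq (mul_ne_zero hN ha) (a * j + b) using 4
    ring

theorem progProdAdd_split {q : ℂ} (hq : ‖q‖ < 1) {a : ℕ} (ha : a ≠ 0) (b : ℕ) (N : ℕ)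
    (hN : N ≠ 0) :
    progProdAdd a b q = ∏ j ∈ Finset.range N, progProdAdd (N * a) (a * j + b) q := by
  unfold progProdAdd
  rw [tprod_residueClasses N hN (multipliable_one_add_pow hq ha b)]
  · refine Finset.prod_congr rfl fun j _ => tprod_congr fun n => ?_
    ring_nf
  · intro j _
    convert multipliable_one_add_pow hq (mul_ne_zero hN ha) (a * j + b) using 4
    ring

theorem progProd_mul_progProdAdd {q : ℂ} (hq : ‖q‖ < 1) {a : ℕ} (ha : a ≠ 0) (b : ℕ) :
    progProd a b q * progProdAdd a b q = progProd (2 * a) (2 * b) q := by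
  unfold progProd progProdAdd
  rw [← (multipliable_one_sub_pow hq ha b).tprod_mul (multipliable_one_add_pow hq ha b)]
  refine tprod_congr fun n => ?_
  ring

/-- The product of `1 - q ^ n` over the odd `n` is `f₁ / f₂`. -/
theorem progProd_two_one {q : ℂ} (hq : ‖q‖ < 1) :
    progProd 2 1 q * eulerF 2 q = eulerF 1 q := by
  rw [eulerF_eq_progProd, eulerF_eq_progProd, progProd_split hq one_ne_zero 1 2 two_ne_zero]
  simp [Finset.prod_range_succ]

/-- Changing the sign of `q`: `f₁(-q) = f₂³ / (f₁ f₄)`. -/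
theorem eulerF_one_neg {q : ℂ} (hq : ‖q‖ < 1) :
    eulerF 1 q * eulerF 1 (-q) * eulerF 4 q = eulerF 2 q ^ 3 := by
  have hq' : ‖-q‖ < 1 := by rwa [norm_neg]
  have h1 := progProd_two_one hq
  have h2 := progProd_two_one hq'
  have h3 : eulerF 2 (-q) = eulerF 2 q := by
    simp only [eulerF, pow_mul, neg_sq]
  have h4 : progProd 2 1 (-q) = progProdAdd 2 1 q := by
    unfold progProd progProdAdd
    refine tprod_congr fun n => ?_
    rw [Odd.neg_pow ⟨n, rfl⟩, sub_neg_eq_add]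
  have h5 : progProd (2 * 2) (2 * 1) q * eulerF 4 q = eulerF 2 q := by
    have := progProd_two_one (norm_pow_lt_one hq two_ne_zero)
    rw [eulerF_pow, eulerF_pow] at this
    convert this using 2
    simp only [progProd, ← pow_mul]
    refine tprod_congr fun n => ?_
    ring_nf
  rw [← progProd_mul_progProdAdd hq two_ne_zero] at h5
  rw [h3, h4] at h2
  rw [← h1, ← h2]
  linear_combination eulerF 2 q ^ 2 * h5

theorem eulerF_five_neg {q : ℂ} (hq : ‖q‖ < 1) :
    eulerF 5 q * eulerF 5 (-q) * eulerF 20 q = eulerF 10 q ^ 3 := by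
  have h := eulerF_one_neg (norm_pow_lt_one hq (by norm_num : (5 : ℕ) ≠ 0))
  have h5 : -q ^ 5 = (-q) ^ 5 := (Odd.neg_pow ⟨2, rfl⟩ q).symm
  rw [h5] at h
  simpa only [eulerF_pow] using h

/-! ### The Jacobi triple product -/

/-- The finite product `∏_{1 ≤ i ≤ n} (1 - Q ^ i)`. -/
noncomputable def qPoch (Q : ℂ) (n : ℕ) : ℂ := ∏ i ∈ Finset.range n, (1 - Q ^ (i + 1))

/-- The reciprocal of `qPoch Q n`, extended by `0` to negative `n`; with this convention the
recurrence `qPochInv_sub_one` holds for all integers `n`. -/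
noncomputable def qPochInv (Q : ℂ) (n : ℤ) : ℂ := if 0 ≤ n then (qPoch Q n.toNat)⁻¹ else 0

theorem qPochInv_natCast (Q : ℂ) (n : ℕ) : qPochInv Q n = (qPoch Q n)⁻¹ := by
  simp [qPochInv]

theorem qPochInv_of_neg (Q : ℂ) {n : ℤ} (hn : n < 0) : qPochInv Q n = 0 := by
  simp [qPochInv, hn.not_ge]

theorem qPochInv_sub_one {Q : ℂ} (hQ : ‖Q‖ < 1) (n : ℤ) :
    qPochInv Q (n - 1) = (1 - Q ^ n) * qPochInv Q n := by
  rcases lt_trichotomy n 0 with hn | rfl | hn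
  · rw [qPochInv_of_neg Q hn, qPochInv_of_neg Q (by omega), mul_zero]
  · simp [qPochInv_of_neg]
  · obtain ⟨m, rfl⟩ : ∃ m : ℕ, n = (m + 1 : ℕ) := ⟨n.toNat - 1, by omega⟩
    have h0 : 1 - Q ^ (m + 1) ≠ 0 :=
      one_sub_ne_zero_of_norm_lt (norm_pow_lt_one hQ (Nat.succ_ne_zero _))
    have h : ((m + 1 : ℕ) : ℤ) - 1 = m := by simp
    rw [h, qPochInv_natCast, qPochInv_natCast, zpow_natCast, qPoch, qPoch, Finset.prod_range_succ,
      mul_inv, mul_left_comm, mul_inv_cancel₀ h0, mul_one]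

/-- The recurrence in `N` for the coefficients `(Q)_{2N} / ((Q)_{N-k} (Q)_{N+k})` of the finite
triple product, `Q = s²`. -/
theorem qPochInv_mul_recurrence {s : ℂ} (hs : ‖s‖ < 1) (hs0 : s ≠ 0) (N : ℕ) (k : ℤ) :
    (1 + s ^ (4 * N + 2)) * (qPochInv (s ^ 2) (N - k) * qPochInv (s ^ 2) (N + k) * s ^ (k ^ 2))
      + s ^ (2 * N + 1) *
        (qPochInv (s ^ 2) (N - (k - 1)) * qPochInv (s ^ 2) (N + (k - 1)) * s ^ ((k - 1) ^ 2)
        + qPochInv (s ^ 2) (N - (k + 1)) * qPochInv (s ^ 2) (N + (k + 1)) * s ^ ((k + 1) ^ 2))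
      = (1 - (s ^ 2) ^ (2 * N + 1)) * (1 - (s ^ 2) ^ (2 * N + 2)) *
        (qPochInv (s ^ 2) ((N + 1 : ℕ) - k) * qPochInv (s ^ 2) ((N + 1 : ℕ) + k)
          * s ^ (k ^ 2)) := by
  have hQ := norm_pow_lt_one hs two_ne_zero
  set e := qPochInv (s ^ 2)
  have r1 : e (N - k) = (1 - (s ^ 2) ^ (N + 1 - k : ℤ)) * e (N + 1 - k) := by
    rw [← qPochInv_sub_one hQ]; congr 1; ring
  have r2 : e (N + k) = (1 - (s ^ 2) ^ (N + 1 + k : ℤ)) * e (N + 1 + k) := by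
    rw [← qPochInv_sub_one hQ]; congr 1; ring
  have r3 : e (N - (k + 1)) = (1 - (s ^ 2) ^ (N - k : ℤ)) * e (N - k) := by
    rw [← qPochInv_sub_one hQ]; congr 1; ring
  have r4 : e (N + (k - 1)) = (1 - (s ^ 2) ^ (N + k : ℤ)) * e (N + k) := by
    rw [← qPochInv_sub_one hQ]; congr 1; ring
  have r5 : e (N - (k - 1)) = e (N + 1 - k) := by congr 1; ring
  have r6 : e (N + (k + 1)) = e (N + 1 + k) := by congr 1; ring
  rw [r3, r4, r5, r6, r1, r2]
  have ek : s ^ ((k - 1) ^ 2) = s ^ (k ^ 2) * (s ^ k)⁻¹ ^ 2 * s := by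
    rw [← zpow_neg, ← zpow_natCast, ← zpow_mul, ← zpow_add₀ hs0, ← zpow_add_one₀ hs0]
    congr 1; push_cast; ring
  have ek' : s ^ ((k + 1) ^ 2) = s ^ (k ^ 2) * (s ^ k) ^ 2 * s := by
    rw [← zpow_natCast, ← zpow_mul, ← zpow_add₀ hs0, ← zpow_add_one₀ hs0]
    congr 1; push_cast; ring
  have hN : ∀ j : ℤ, (s ^ 2) ^ j = (s ^ j) ^ 2 := fun j => by
    rw [← zpow_natCast, ← zpow_natCast, ← zpow_mul, ← zpow_mul, mul_comm]
  have h1 : s ^ (N + 1 - k : ℤ) = s ^ N * s * (s ^ k)⁻¹ := by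
    rw [zpow_sub₀ hs0, zpow_add_one₀ hs0, zpow_natCast, div_eq_mul_inv]
  have h2 : s ^ (N + 1 + k : ℤ) = s ^ N * s * s ^ k := by
    rw [zpow_add₀ hs0, zpow_add_one₀ hs0, zpow_natCast]
  have h3 : s ^ (N - k : ℤ) = s ^ N * (s ^ k)⁻¹ := by
    rw [zpow_sub₀ hs0, zpow_natCast, div_eq_mul_inv]
  have h4 : s ^ (N + k : ℤ) = s ^ N * s ^ k := by
    rw [zpow_add₀ hs0, zpow_natCast]
  rw [ek, ek', hN, hN, hN, hN, h1, h2, h3, h4]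
  have hk0 : s ^ k ≠ 0 := zpow_ne_zero _ hs0
  push_cast
  generalize e (N + 1 - k) = E
  generalize e (N + 1 + k) = F
  generalize s ^ (k ^ 2) = w
  have p1 : s ^ (4 * N + 2) = (s ^ N) ^ 4 * s ^ 2 := by ring
  have p2 : s ^ (2 * N + 1) = (s ^ N) ^ 2 * s := by ring
  have p3 : (s ^ 2) ^ (2 * N + 1) = (s ^ N) ^ 4 * s ^ 2 := by ring
  have p4 : (s ^ 2) ^ (2 * N + 2) = (s ^ N) ^ 4 * s ^ 4 := by ring
  rw [p1, p2, p3, p4]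
  generalize s ^ k = u at *
  generalize s ^ N = v
  field_simp
  ring

/-- The finite form of the Jacobi triple product. -/
theorem hasSum_finite_triple_product {s z : ℂ} (hs : ‖s‖ < 1) (hs0 : s ≠ 0) (hz : z ≠ 0) (N : ℕ) :
    HasSum (fun k : ℤ => qPoch (s ^ 2) (2 * N) *
        (qPochInv (s ^ 2) (N - k) * qPochInv (s ^ 2) (N + k) * s ^ (k ^ 2)) * z ^ k)
      (∏ i ∈ Finset.range N, (1 + z * s ^ (2 * i + 1)) * (1 + z⁻¹ * s ^ (2 * i + 1))) := by
  induction N with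
  | zero =>
    have : (∏ i ∈ Finset.range 0, (1 + z * s ^ (2 * i + 1)) * (1 + z⁻¹ * s ^ (2 * i + 1))) =
        qPoch (s ^ 2) (2 * 0) * (qPochInv (s ^ 2) ((0 : ℕ) - 0) * qPochInv (s ^ 2) ((0 : ℕ) + 0)
          * s ^ ((0 : ℤ) ^ 2)) * z ^ (0 : ℤ) := by
      simp [qPoch, qPochInv]
    rw [this]
    refine hasSum_single (0 : ℤ) fun k hk => ?_
    rcases lt_or_gt_of_ne hk with hk | hk
    · simp [qPochInv_of_neg, hk]
    · simp [qPochInv_of_neg, hk]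
  | succ N ih =>
    rw [Finset.prod_range_succ]
    set g : ℤ → ℂ := fun k => qPoch (s ^ 2) (2 * N) *
        (qPochInv (s ^ 2) (N - k) * qPochInv (s ^ 2) (N + k) * s ^ (k ^ 2)) * z ^ k with hg
    set P := ∏ i ∈ Finset.range N, (1 + z * s ^ (2 * i + 1)) * (1 + z⁻¹ * s ^ (2 * i + 1))
    have hm : HasSum (fun k : ℤ => g (k - 1)) P :=
      ((Equiv.subRight (1 : ℤ)).hasSum_iff (f := g)).mpr ih
    have hp : HasSum (fun k : ℤ => g (k + 1)) P :=
      ((Equiv.addRight (1 : ℤ)).hasSum_iff (f := g)).mpr ih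
    have := (ih.mul_left (1 + s ^ (4 * N + 2))).add
      ((hm.mul_left (z * s ^ (2 * N + 1))).add (hp.mul_left (z⁻¹ * s ^ (2 * N + 1))))
    have hP0 : P * ((1 + z * s ^ (2 * N + 1)) * (1 + z⁻¹ * s ^ (2 * N + 1))) =
        (1 + s ^ (4 * N + 2)) * P + (z * s ^ (2 * N + 1) * P + z⁻¹ * s ^ (2 * N + 1) * P) := by
      have : z * z⁻¹ = 1 := mul_inv_cancel₀ hz
      linear_combination (P * s ^ (4 * N + 2)) * this
    rw [hP0]
    refine this.congr_fun fun k => ?_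
    have hr := qPochInv_mul_recurrence hs hs0 N k
    have hP : qPoch (s ^ 2) (2 * (N + 1)) = qPoch (s ^ 2) (2 * N) *
        ((1 - (s ^ 2) ^ (2 * N + 1)) * (1 - (s ^ 2) ^ (2 * N + 2))) := by
      rw [mul_add, mul_one, qPoch, Finset.prod_range_succ, Finset.prod_range_succ, ← qPoch]
      ring
    simp only [hg]
    rw [hP, zpow_sub_one₀ hz, zpow_add_one₀ hz]
    have : z * z⁻¹ = 1 := mul_inv_cancel₀ hz
    linear_combination (-qPoch (s ^ 2) (2 * N) * z ^ k) * hr - (qPoch (s ^ 2) (2 * N) * z ^ k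
      * s ^ (2 * N + 1) *
      (qPochInv (s ^ 2) (N - (k - 1)) * qPochInv (s ^ 2) (N + (k - 1)) * s ^ ((k - 1) ^ 2)
      + qPochInv (s ^ 2) (N - (k + 1)) * qPochInv (s ^ 2) (N + (k + 1)) * s ^ ((k + 1) ^ 2)))
      * this

theorem summable_zpow_sq_mul_zpow {s z : ℂ} (hs : ‖s‖ < 1) (hs0 : s ≠ 0) (hz : z ≠ 0) :
    Summable fun k : ℤ => s ^ (k ^ 2) * z ^ k := by
  have hpi : (Real.pi : ℂ) ≠ 0 := by exact_mod_cast Real.pi_ne_zero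
  have hpi' := Real.pi_pos
  have hτ : 0 < (Complex.log s / (Real.pi * Complex.I)).im := by
    have : (Complex.log s / (Real.pi * Complex.I)) = (-(Complex.log s / Real.pi)) * Complex.I := by
      field_simp
      simp
    rw [this]
    have hl : Real.log ‖s‖ < 0 := Real.log_neg (norm_pos_iff.mpr hs0) hs
    simp only [Complex.mul_I_im, Complex.neg_re, Complex.div_ofReal_re, Complex.log_re]
    exact neg_pos.mpr (div_neg_of_neg_of_pos hl hpi')
  refine ((summable_jacobiTheta₂_term_iff (Complex.log z / (2 * Real.pi * Complex.I)) _).mpr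
    hτ).congr fun k => ?_
  have e1 : s ^ (k ^ 2) = Complex.exp ((k ^ 2 : ℤ) * Complex.log s) := by
    rw [Complex.exp_int_mul, Complex.exp_log hs0]
  have e2 : z ^ k = Complex.exp (k * Complex.log z) := by
    rw [Complex.exp_int_mul, Complex.exp_log hz]
  rw [jacobiTheta₂_term, e1, e2, ← Complex.exp_add]
  congr 1
  have := Complex.I_ne_zero
  field_simp
  push_cast
  ring

theorem tendsto_qPoch {Q : ℂ} (hQ : ‖Q‖ < 1) :
    Tendsto (qPoch Q) atTop (𝓝 (eulerF 1 Q)) := by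
  have h := (multipliable_one_sub_pow hQ one_ne_zero 1).tendsto_prod_tprod_nat
  rw [eulerF_eq_progProd, progProd]
  simp only [one_mul] at h ⊢
  exact h

/-- The **Jacobi triple product** identity. -/
theorem tsum_zpow_sq_mul_zpow {s z : ℂ} (hs : ‖s‖ < 1) (hs0 : s ≠ 0) (hz : z ≠ 0) :
    ∑' k : ℤ, s ^ (k ^ 2) * z ^ k =
      eulerF 2 s * (∏' n : ℕ, (1 + z * s ^ (2 * n + 1))) * ∏' n : ℕ, (1 + z⁻¹ * s ^ (2 * n + 1)) := by
  have hQ := norm_pow_lt_one hs two_ne_zero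
  have hne : eulerF 1 (s ^ 2) ≠ 0 := eulerF_ne_zero hQ one_ne_zero
  have hinv : Tendsto (fun n : ℕ => qPochInv (s ^ 2) n) atTop (𝓝 (eulerF 1 (s ^ 2))⁻¹) :=
    by simpa only [qPochInv_natCast] using (tendsto_qPoch hQ).inv₀ hne
  obtain ⟨C, hC⟩ : ∃ C : ℝ, ∀ n : ℤ, ‖qPochInv (s ^ 2) n‖ ≤ C := by
    obtain ⟨C, hC⟩ := (Metric.isBounded_range_of_tendsto _ hinv).exists_norm_le
    refine ⟨C, fun n => ?_⟩
    rcases lt_or_ge n 0 with hn | hn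
    · simpa [qPochInv_of_neg _ hn] using (norm_nonneg _).trans (hC _ ⟨0, rfl⟩)
    · lift n to ℕ using hn
      exact hC _ ⟨n, rfl⟩
  obtain ⟨D, hD⟩ := (Metric.isBounded_range_of_tendsto _ (tendsto_qPoch hQ)).exists_norm_le
  have hD0 : 0 ≤ D := (norm_nonneg _).trans (hD _ ⟨0, rfl⟩)
  have hC0 : 0 ≤ C := (norm_nonneg _).trans (hC 0)
  have hsm := summable_zpow_sq_mul_zpow hs hs0 hz
  have htop : ∀ k : ℤ, Tendsto (fun N : ℕ => qPochInv (s ^ 2) (N + k)) atTop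
      (𝓝 (eulerF 1 (s ^ 2))⁻¹) := by
    intro k
    have h1 : Tendsto (fun N : ℕ => ((N : ℤ) + k).toNat) atTop atTop :=
      tendsto_atTop.mpr fun b => eventually_atTop.mpr ⟨b + k.natAbs, fun N hN => by omega⟩
    refine (hinv.comp h1).congr' (eventually_atTop.mpr ⟨k.natAbs, fun N hN => ?_⟩)
    simp only [Function.comp]
    rw [Int.toNat_of_nonneg (by omega)]
  have hlim := tendsto_tsum_of_dominated_convergence
    (𝓕 := atTop) (f := fun (N : ℕ) (k : ℤ) => qPoch (s ^ 2) (2 * N) *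
        (qPochInv (s ^ 2) (N - k) * qPochInv (s ^ 2) (N + k) * s ^ (k ^ 2)) * z ^ k)
    (g := fun k => eulerF 1 (s ^ 2) * ((eulerF 1 (s ^ 2))⁻¹ * (eulerF 1 (s ^ 2))⁻¹ * s ^ (k ^ 2))
      * z ^ k)
    (bound := fun k => D * (C * C) * ‖s ^ (k ^ 2) * z ^ k‖) (hsm.norm.mul_left _)
    (fun k => by
      refine Tendsto.mul_const _ (Tendsto.mul ?_ (Tendsto.mul_const _ (Tendsto.mul ?_ (htop k))))
      · exact (tendsto_qPoch hQ).comp (tendsto_id.const_mul_atTop' two_pos)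
      · simpa only [sub_eq_add_neg] using htop (-k))
    (Eventually.of_forall fun N k => by
      have h1 := hD _ ⟨2 * N, rfl⟩
      have h2 := hC (N - k)
      have h3 := hC (N + k)
      calc _ = ‖qPoch (s ^ 2) (2 * N)‖ * (‖qPochInv (s ^ 2) (N - k)‖ *
            ‖qPochInv (s ^ 2) (N + k)‖) * ‖s ^ (k ^ 2) * z ^ k‖ := by
            simp only [norm_mul]; ring
        _ ≤ _ := by gcongr)
  simp_rw [(hasSum_finite_triple_product hs hs0 hz _).tsum_eq] at hlim
  have hmul : ∀ w : ℂ, Multipliable fun n : ℕ => 1 + w * s ^ (2 * n + 1) := fun w =>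
    multipliable_one_add_of_summable (by
      simpa only [norm_mul] using (summable_norm_pow_mul_add hs two_ne_zero 1).mul_left ‖w‖)
  have hlim' : Tendsto (fun N : ℕ => ∏ i ∈ Finset.range N,
      (1 + z * s ^ (2 * i + 1)) * (1 + z⁻¹ * s ^ (2 * i + 1))) atTop
      (𝓝 ((∏' n : ℕ, (1 + z * s ^ (2 * n + 1))) * ∏' n : ℕ, (1 + z⁻¹ * s ^ (2 * n + 1)))) := by
    simp_rw [Finset.prod_mul_distrib]
    exact (hmul z).tendsto_prod_tprod_nat.mul (hmul z⁻¹).tendsto_prod_tprod_nat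
  have heq := tendsto_nhds_unique hlim hlim'
  have hsum : ∑' k : ℤ, eulerF 1 (s ^ 2) * ((eulerF 1 (s ^ 2))⁻¹ * (eulerF 1 (s ^ 2))⁻¹
      * s ^ (k ^ 2)) * z ^ k = (eulerF 1 (s ^ 2))⁻¹ * ∑' k : ℤ, s ^ (k ^ 2) * z ^ k := by
    rw [← tsum_mul_left]
    refine tsum_congr fun k => ?_
    field_simp
  rw [hsum] at heq
  have h2 : eulerF 1 (s ^ 2) = eulerF 2 s := eulerF_pow 1 2 s
  rw [mul_assoc, ← heq, h2, mul_inv_cancel_left₀ (h2 ▸ hne)]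

/-! ### Theta series and a sublattice of index five -/

/-- The theta series `∑ s ^ (A n² + B n)` over all integers `n`. In Ramanujan's notation
`f(a, b) = ∑ a ^ (n(n+1)/2) b ^ (n(n-1)/2)` it is `f(s ^ (A + B), s ^ (A - B))`. -/
noncomputable def thetaSeries (A : ℕ) (B : ℤ) (s : ℂ) : ℂ := ∑' n : ℤ, s ^ (A * n ^ 2 + B * n)

theorem zpow_quadratic {s : ℂ} (hs0 : s ≠ 0) (A : ℕ) (B n : ℤ) :
    s ^ (A * n ^ 2 + B * n) = (s ^ A) ^ (n ^ 2) * (s ^ B) ^ n := by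
  rw [zpow_add₀ hs0, zpow_mul, zpow_mul, zpow_natCast]

theorem summable_thetaSeries {s : ℂ} (hs : ‖s‖ < 1) (hs0 : s ≠ 0) {A : ℕ} (hA : A ≠ 0) (B : ℤ) :
    Summable fun n : ℤ => s ^ (A * n ^ 2 + B * n) := by
  simp_rw [zpow_quadratic hs0]
  exact summable_zpow_sq_mul_zpow (norm_pow_lt_one hs hA) (pow_ne_zero _ hs0) (zpow_ne_zero _ hs0)

theorem thetaSeries_neg (A : ℕ) (B : ℤ) (s : ℂ) : thetaSeries A (-B) s = thetaSeries A B s := by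
  unfold thetaSeries
  rw [← (Equiv.neg ℤ).tsum_eq]
  refine tsum_congr fun n => ?_
  simp

/-- Translation of the summation index by `1`. -/
theorem thetaSeries_shift {s : ℂ} (hs0 : s ≠ 0) (A : ℕ) (B : ℤ) :
    thetaSeries A B s = s ^ (A - B) * thetaSeries A (B - 2 * A) s := by
  unfold thetaSeries
  rw [← (Equiv.subRight (1 : ℤ)).tsum_eq, ← tsum_mul_left]
  refine tsum_congr fun n => ?_
  rw [← zpow_add₀ hs0, Equiv.subRight_apply]
  congr 1
  ring

theorem thetaSeries_pow {s : ℂ} (k : ℕ) (A : ℕ) (B : ℤ) :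
    thetaSeries A B (s ^ k) = thetaSeries (k * A) (k * B) s := by
  unfold thetaSeries
  refine tsum_congr fun n => ?_
  rw [← zpow_natCast, ← zpow_mul]
  congr 1
  push_cast
  ring

/-- Product expansion of a theta series, from the Jacobi triple product. -/
theorem thetaSeries_eq_prod {s : ℂ} (hs : ‖s‖ < 1) (hs0 : s ≠ 0) {A B : ℕ} (hA : A ≠ 0)
    (hB : B ≤ A) :
    thetaSeries A B s =
      eulerF (2 * A) s * progProdAdd (2 * A) (A + B) s * progProdAdd (2 * A) (A - B) s := by
  have h := tsum_zpow_sq_mul_zpow (norm_pow_lt_one hs hA) (pow_ne_zero _ hs0)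
    (zpow_ne_zero (B : ℤ) hs0)
  unfold thetaSeries
  simp_rw [zpow_quadratic hs0]
  rw [h, eulerF_pow, mul_comm A 2]
  congr 1
  · congr 1
    refine tprod_congr fun n => ?_
    rw [zpow_natCast]
    ring
  · refine tprod_congr fun n => ?_
    have : s ^ (2 * A * n + (A - B)) * s ^ B = (s ^ A) ^ (2 * n + 1) := by
      rw [← pow_add, ← pow_mul]
      congr 1
      have : A * (2 * n + 1) = 2 * A * n + A := by ring
      omega
    rw [zpow_natCast, ← this, mul_comm _ (s ^ B), inv_mul_cancel_left₀ (pow_ne_zero _ hs0)]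

/-- Representatives of the five cosets of the sublattice `{(m + 2n, 2m - n)}` in `ℤ²`. -/
def cosetRep : Fin 5 → ℤ × ℤ := ![(0, 0), (0, 1), (-1, 0), (1, 0), (0, -1)]

theorem bijective_coset : Function.Bijective fun p : Fin 5 × ℤ × ℤ =>
    ((p.2.1 + 2 * p.2.2 + (cosetRep p.1).1, 2 * p.2.1 - p.2.2 + (cosetRep p.1).2) : ℤ × ℤ) := by
  constructor
  · rintro ⟨c, m, n⟩ ⟨c', m', n'⟩ h
    fin_cases c <;> fin_cases c' <;>
      simp only [cosetRep, Prod.mk.injEq, Fin.mk_zero, Fin.mk_one, Fin.reduceFinMk, Fin.isValue,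
        Matrix.cons_val] at h ⊢ <;> first | (exfalso; omega) | exact ⟨trivial, by omega, by omega⟩
  · rintro ⟨x, y⟩
    have key : ∃ c : Fin 5, (5 : ℤ) ∣ (y - (cosetRep c).2) - 2 * (x - (cosetRep c).1) := by
      have h5 : (y - 2 * x) % 5 = 0 ∨ (y - 2 * x) % 5 = 1 ∨ (y - 2 * x) % 5 = 2 ∨
        (y - 2 * x) % 5 = 3 ∨ (y - 2 * x) % 5 = 4 := by omega
      rcases h5 with h | h | h | h | h
      · exact ⟨0, by simp only [cosetRep, Matrix.cons_val]; omega⟩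
      · exact ⟨1, by simp only [cosetRep, Matrix.cons_val]; omega⟩
      · exact ⟨2, by simp only [cosetRep, Matrix.cons_val]; omega⟩
      · exact ⟨3, by simp only [cosetRep, Matrix.cons_val]; omega⟩
      · exact ⟨4, by simp only [cosetRep, Matrix.cons_val]; omega⟩
    -- solving `m + 2n = x'`, `2m - n = y'` gives `5 n = 2 x' - y'` and `m = x' - 2n`
    obtain ⟨c, k, hk⟩ := key
    exact ⟨(c, x - (cosetRep c).1 + 2 * k, -k), Prod.ext (by simp) (by simp only; linarith)⟩

/-- The square of a theta series splits over the cosets of the sublattice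
`{(m + 2n, 2m - n)}`, on which the form `x² + y²` becomes `5 (m² + n²)`. -/
theorem thetaSeries_one_sq {s : ℂ} (hs : ‖s‖ < 1) (hs0 : s ≠ 0) (B : ℤ) :
    thetaSeries 1 B s ^ 2 = ∑ c : Fin 5,
      s ^ ((cosetRep c).1 ^ 2 + (cosetRep c).2 ^ 2 + B * ((cosetRep c).1 + (cosetRep c).2)) *
        (thetaSeries 5 (2 * (cosetRep c).1 + 4 * (cosetRep c).2 + 3 * B) s *
         thetaSeries 5 (4 * (cosetRep c).1 - 2 * (cosetRep c).2 + B) s) := by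
  have h1 := summable_thetaSeries hs hs0 one_ne_zero B
  have h5 := fun C => summable_thetaSeries hs hs0 (by norm_num : 5 ≠ 0) C
  have hS := summable_mul_of_summable_norm h1.norm h1.norm
  have hE := (Equiv.ofBijective _ bijective_coset).tsum_eq fun p : ℤ × ℤ =>
    s ^ ((1 : ℕ) * p.1 ^ 2 + B * p.1) * s ^ ((1 : ℕ) * p.2 ^ 2 + B * p.2)
  rw [sq, thetaSeries, tsum_mul_tsum_of_summable_norm h1.norm h1.norm]
  refine hE.symm.trans
    ((((Equiv.ofBijective _ bijective_coset).summable_iff.mpr hS).tsum_prod).trans ?_)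
  rw [tsum_fintype]
  refine Finset.sum_congr rfl fun c _ => ?_
  rw [thetaSeries, thetaSeries, tsum_mul_tsum_of_summable_norm (h5 _).norm (h5 _).norm,
    ← tsum_mul_left]
  refine tsum_congr fun p => ?_
  simp only [Function.comp, Equiv.ofBijective_apply]
  rw [← zpow_add₀ hs0, ← zpow_add₀ hs0, ← zpow_add₀ hs0]
  congr 1
  push_cast
  ring

/-- `φ(s)² = φ(s⁵)² + 4 s f(s³, s⁷) f(s, s⁹)`. -/
theorem thetaSeries_one_zero_sq {s : ℂ} (hs : ‖s‖ < 1) (hs0 : s ≠ 0) :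
    thetaSeries 1 0 s ^ 2 =
      thetaSeries 1 0 (s ^ 5) ^ 2 + 4 * s * thetaSeries 5 2 s * thetaSeries 5 4 s := by
  rw [thetaSeries_one_sq hs hs0, Fin.sum_univ_five, thetaSeries_pow]
  simp only [cosetRep, Matrix.cons_val]
  norm_num [thetaSeries_neg]
  ring

/-- `ψ(q)² = q ψ(q⁵)² + f(q, q⁴) f(q², q³)` for `q = s²`, with `thetaSeries 1 1 s = 2 ψ(q)`. -/
theorem thetaSeries_one_one_sq {s : ℂ} (hs : ‖s‖ < 1) (hs0 : s ≠ 0) :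
    thetaSeries 1 1 s ^ 2 =
      s ^ 2 * thetaSeries 1 1 (s ^ 5) ^ 2 + 4 * (thetaSeries 5 3 s * thetaSeries 5 1 s) := by
  have h7 : s ^ 2 * thetaSeries 5 7 s = thetaSeries 5 3 s := by
    rw [thetaSeries_shift hs0]
    norm_num [thetaSeries_neg]
    exact mul_inv_cancel_left₀ (pow_ne_zero 2 hs0) _
  rw [thetaSeries_one_sq hs hs0, Fin.sum_univ_five, thetaSeries_pow]
  simp only [cosetRep, Matrix.cons_val]
  norm_num [thetaSeries_neg]
  linear_combination thetaSeries 5 1 s * h7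

/-! ### Two quadratic identities of level ten -/

/-- `2 ψ(q) = 2 f₂² / f₁` for `q = s²`; the factor `2` is the first factor `1 + s⁰` of one of the
products in the Jacobi triple product. -/
theorem thetaSeries_one_one_mul {s : ℂ} (hs : ‖s‖ < 1) (hs0 : s ≠ 0) :
    thetaSeries 1 1 s * eulerF 1 (s ^ 2) = 2 * eulerF 2 (s ^ 2) ^ 2 := by
  have hQ := norm_pow_lt_one hs two_ne_zero
  have h := thetaSeries_eq_prod hs hs0 one_ne_zero (le_refl 1)
  have h0 : progProdAdd 2 0 s = 2 * progProdAdd 2 2 s := by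
    unfold progProdAdd
    rw [tprod_eq_zero_mul']
    · simp only [mul_zero, pow_zero, add_zero, mul_add, mul_one]
      norm_num
    · simpa only [mul_add, mul_one, add_zero] using multipliable_one_add_pow hs two_ne_zero 2
  have h1 := progProd_mul_progProdAdd hs two_ne_zero 2
  rw [← eulerF_eq_progProd, ← eulerF_eq_progProd] at h1
  norm_num at h h1
  rw [h, h0, eulerF_pow, eulerF_pow]
  norm_num
  rw [← h1]
  ring

/-- `ψ(q)² - q ψ(q⁵)² = f₂ f₅³ / (f₁ f₁₀)`. -/
theorem eulerF_psi_identity {q : ℂ} (hq : ‖q‖ < 1) (hq0 : q ≠ 0) :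
    eulerF 2 q ^ 4 / eulerF 1 q ^ 2 - q * (eulerF 10 q ^ 4 / eulerF 5 q ^ 2) =
      eulerF 2 q * eulerF 5 q ^ 3 / (eulerF 1 q * eulerF 10 q) := by
  obtain ⟨s, rfl⟩ := IsAlgClosed.exists_pow_nat_eq q two_pos
  have hs0 : s ≠ 0 := fun h => hq0 (by simp [h])
  have hs : ‖s‖ < 1 := by
    by_contra h
    rw [norm_pow] at hq
    exact absurd hq (not_lt.mpr (one_le_pow₀ (not_lt.mp h)))
  have h1 : eulerF 1 (s ^ 2) ≠ 0 := eulerF_ne_zero hq one_ne_zero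
  have h5 : eulerF 5 (s ^ 2) ≠ 0 := eulerF_ne_zero hq (by norm_num)
  have h10 : eulerF 10 (s ^ 2) ≠ 0 := eulerF_ne_zero hq (by norm_num)
  have hA := thetaSeries_one_one_mul hs hs0
  have hB := thetaSeries_one_one_mul (norm_pow_lt_one hs (by norm_num : 5 ≠ 0))
    (pow_ne_zero 5 hs0)
  have h25 : (s ^ 5) ^ 2 = (s ^ 2) ^ 5 := by ring
  rw [h25, eulerF_pow 1 5, eulerF_pow 2 5] at hB
  norm_num only at hB
  have h3 := thetaSeries_eq_prod hs hs0 (by norm_num : 5 ≠ 0) (by norm_num : 3 ≤ 5)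
  have h1' := thetaSeries_eq_prod hs hs0 (by norm_num : 5 ≠ 0) (by norm_num : 1 ≤ 5)
  have hsp := progProdAdd_split hs two_ne_zero 2 5 (by norm_num)
  have hd1 := progProd_mul_progProdAdd hs two_ne_zero 2
  have hd5 := progProd_mul_progProdAdd hs (by norm_num : 10 ≠ 0) 10
  rw [← eulerF_eq_progProd, ← eulerF_eq_progProd] at hd1 hd5
  simp only [Finset.prod_range_succ, Finset.prod_range_zero] at hsp
  have hmain := thetaSeries_one_one_sq hs hs0
  norm_num at h3 h1' hsp hd1 hd5
  rw [h3, h1'] at hmain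
  have e1 : eulerF 1 (s ^ 2) = eulerF 2 s := eulerF_pow 1 2 s
  have e2 : eulerF 2 (s ^ 2) = eulerF 4 s := eulerF_pow 2 2 s
  have e5 : eulerF 5 (s ^ 2) = eulerF 10 s := eulerF_pow 5 2 s
  have e10 : eulerF 10 (s ^ 2) = eulerF 20 s := eulerF_pow 10 2 s
  rw [e1] at h1 hA
  rw [e5] at h5
  rw [e10] at h10
  rw [e2] at hA
  rw [e5, e10] at hB
  rw [e1, e2, e5, e10]
  -- `∏ (1 + q ^ n)` over the `n` prime to `5`, times `f₅²`
  have hprod : (eulerF 10 s * progProdAdd 10 8 s * progProdAdd 10 2 s) *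
      (eulerF 10 s * progProdAdd 10 6 s * progProdAdd 10 4 s) * (eulerF 2 s * eulerF 20 s) =
      eulerF 4 s * eulerF 10 s ^ 3 := by
    rw [← hd1, ← hd5, hsp]
    ring
  have hA' : thetaSeries 1 1 s = 2 * eulerF 4 s ^ 2 / eulerF 2 s := eq_div_of_mul_eq h1 hA
  have hB' : thetaSeries 1 1 (s ^ 5) = 2 * eulerF 20 s ^ 2 / eulerF 10 s := eq_div_of_mul_eq h5 hB
  rw [hA', hB'] at hmain
  rw [eq_div_iff (mul_ne_zero h1 h10), ← hprod]
  linear_combination (eulerF 2 s * eulerF 20 s / 4) * hmain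

/-- `φ(-q) = f₁² / f₂`. -/
theorem thetaSeries_one_zero_neg {q : ℂ} (hq : ‖q‖ < 1) (hq0 : q ≠ 0) :
    thetaSeries 1 0 (-q) * eulerF 2 q = eulerF 1 q ^ 2 := by
  have hq' : ‖-q‖ < 1 := by rwa [norm_neg]
  have h := thetaSeries_eq_prod hq' (neg_ne_zero.mpr hq0) one_ne_zero (zero_le (a := 1))
  have h2 : eulerF 2 (-q) = eulerF 2 q := by simp only [eulerF, pow_mul, neg_sq]
  have h1 : progProdAdd 2 1 (-q) = progProd 2 1 q := by
    unfold progProd progProdAdd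
    refine tprod_congr fun n => ?_
    rw [Odd.neg_pow ⟨n, rfl⟩, ← sub_eq_add_neg]
  norm_num at h
  rw [h, h1, h2, ← progProd_two_one hq]
  ring

/-- `φ(-q⁵)² - φ(-q)² = 4 q f₁ f₁₀³ / (f₂ f₅)`. -/
theorem eulerF_phi_identity {q : ℂ} (hq : ‖q‖ < 1) (hq0 : q ≠ 0) :
    eulerF 5 q ^ 4 / eulerF 10 q ^ 2 - eulerF 1 q ^ 4 / eulerF 2 q ^ 2 =
      4 * q * (eulerF 1 q * eulerF 10 q ^ 3) / (eulerF 2 q * eulerF 5 q) := by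
  have hq' : ‖-q‖ < 1 := by rwa [norm_neg]
  have hn0 : -q ≠ 0 := neg_ne_zero.mpr hq0
  have h5n : (-q) ^ 5 = -q ^ 5 := Odd.neg_pow ⟨2, rfl⟩ q
  have h2 : eulerF 2 q ≠ 0 := eulerF_ne_zero hq two_ne_zero
  have h5 : eulerF 5 q ≠ 0 := eulerF_ne_zero hq (by norm_num)
  have h10 : eulerF 10 q ≠ 0 := eulerF_ne_zero hq (by norm_num)
  have hA := thetaSeries_one_zero_neg hq hq0
  have hB := thetaSeries_one_zero_neg (norm_pow_lt_one hq (by norm_num : 5 ≠ 0))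
    (pow_ne_zero 5 hq0)
  rw [eulerF_pow, eulerF_pow] at hB
  norm_num at hB
  have t2 := thetaSeries_eq_prod hq' hn0 (by norm_num : 5 ≠ 0) (by norm_num : 2 ≤ 5)
  have t4 := thetaSeries_eq_prod hq' hn0 (by norm_num : 5 ≠ 0) (by norm_num : 4 ≤ 5)
  have hodd : ∀ b, Odd b → progProdAdd 10 b (-q) = progProd 10 b q := by
    intro b hb
    unfold progProd progProdAdd
    refine tprod_congr fun n => ?_
    have : Odd (10 * n + b) := Even.add_odd ⟨5 * n, by ring⟩ hb
    rw [this.neg_pow, ← sub_eq_add_neg]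
  have h10n : eulerF 10 (-q) = eulerF 10 q := by
    have := fun x : ℂ => eulerF_pow 5 2 x
    norm_num at this
    rw [← this, ← this, neg_sq]
  have hmain := thetaSeries_one_zero_sq hq' hn0
  norm_num at t2 t4
  rw [t2, t4, h5n, h10n, hodd 7 ⟨3, rfl⟩, hodd 3 ⟨1, rfl⟩, hodd 9 ⟨4, rfl⟩, hodd 1 ⟨0, rfl⟩]
    at hmain
  have hsp := progProd_split hq two_ne_zero 1 5 (by norm_num)
  simp only [Finset.prod_range_succ, Finset.prod_range_zero] at hsp
  norm_num at hsp
  have hd1 := progProd_two_one hq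
  have hd5 : progProd 10 5 q * eulerF 10 q = eulerF 5 q := by
    rw [eulerF_eq_progProd, eulerF_eq_progProd,
      progProd_split hq (by norm_num : 5 ≠ 0) 5 2 two_ne_zero]
    simp [Finset.prod_range_succ]
  have hprod : (eulerF 10 q * progProd 10 7 q * progProd 10 3 q) *
      (eulerF 10 q * progProd 10 9 q * progProd 10 1 q) * (eulerF 2 q * eulerF 5 q) =
      eulerF 1 q * eulerF 10 q ^ 3 := by
    rw [← hd1, ← hd5, hsp]
    ring
  rw [eq_div_of_mul_eq h2 hA, eq_div_of_mul_eq h10 hB] at hmain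
  rw [eq_div_iff (mul_ne_zero h2 h5), ← hprod]
  linear_combination (-(eulerF 2 q * eulerF 5 q)) * hmain

/-! ### The Hauptmodul of level ten and its behaviour under `q ↦ -q` -/

/-- The function `t = f₁³ f₅ / (q f₂ f₁₀³)`, a Hauptmodul of level ten. -/
noncomputable def hauptmodul (q : ℂ) : ℂ :=
  eulerF 1 q ^ 3 * eulerF 5 q / (q * eulerF 2 q * eulerF 10 q ^ 3)

theorem eulerF_neg_of_even {m : ℕ} (hm : Even m) (q : ℂ) : eulerF m (-q) = eulerF m q := by
  unfold eulerF
  refine tprod_congr fun n => ?_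
  rw [(hm.mul_right _).neg_pow]

/-- Equivalent to `eulerF_phi_identity`. -/
theorem hauptmodul_add_four {q : ℂ} (hq : ‖q‖ < 1) (hq0 : q ≠ 0) :
    hauptmodul q + 4 = eulerF 2 q * eulerF 5 q ^ 5 / (q * eulerF 1 q * eulerF 10 q ^ 5) := by
  have h := eulerF_phi_identity hq hq0
  have h1 : eulerF 1 q ≠ 0 := eulerF_ne_zero hq one_ne_zero
  have h2 : eulerF 2 q ≠ 0 := eulerF_ne_zero hq two_ne_zero
  have h5 : eulerF 5 q ≠ 0 := eulerF_ne_zero hq (by norm_num)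
  have h10 : eulerF 10 q ≠ 0 := eulerF_ne_zero hq (by norm_num)
  unfold hauptmodul
  field_simp at h ⊢
  linear_combination -h

/-- Given the product for `t + 4`, equivalent to `eulerF_psi_identity`. -/
theorem hauptmodul_add_five {q : ℂ} (hq : ‖q‖ < 1) (hq0 : q ≠ 0) :
    hauptmodul q + 5 = eulerF 2 q ^ 4 * eulerF 5 q ^ 2 / (q * eulerF 1 q ^ 2 * eulerF 10 q ^ 4) := by
  have h := eulerF_psi_identity hq hq0
  have h4 := hauptmodul_add_four hq hq0
  have h1 : eulerF 1 q ≠ 0 := eulerF_ne_zero hq one_ne_zero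
  have h2 : eulerF 2 q ≠ 0 := eulerF_ne_zero hq two_ne_zero
  have h5 : eulerF 5 q ≠ 0 := eulerF_ne_zero hq (by norm_num)
  have h10 : eulerF 10 q ≠ 0 := eulerF_ne_zero hq (by norm_num)
  have : hauptmodul q + 5 =
      eulerF 2 q * eulerF 5 q ^ 5 / (q * eulerF 1 q * eulerF 10 q ^ 5) + 1 := by
    rw [← h4]; ring
  rw [this]
  field_simp at h ⊢
  linear_combination -h

theorem hauptmodul_ne_zero {q : ℂ} (hq : ‖q‖ < 1) (hq0 : q ≠ 0) : hauptmodul q ≠ 0 := by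
  have h1 : eulerF 1 q ≠ 0 := eulerF_ne_zero hq one_ne_zero
  have h2 : eulerF 2 q ≠ 0 := eulerF_ne_zero hq two_ne_zero
  have h5 : eulerF 5 q ≠ 0 := eulerF_ne_zero hq (by norm_num)
  have h10 : eulerF 10 q ≠ 0 := eulerF_ne_zero hq (by norm_num)
  unfold hauptmodul
  positivity

theorem hauptmodul_add_four_ne_zero {q : ℂ} (hq : ‖q‖ < 1) (hq0 : q ≠ 0) :
    hauptmodul q + 4 ≠ 0 := by
  have h1 : eulerF 1 q ≠ 0 := eulerF_ne_zero hq one_ne_zero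
  have h2 : eulerF 2 q ≠ 0 := eulerF_ne_zero hq two_ne_zero
  have h5 : eulerF 5 q ≠ 0 := eulerF_ne_zero hq (by norm_num)
  have h10 : eulerF 10 q ≠ 0 := eulerF_ne_zero hq (by norm_num)
  rw [hauptmodul_add_four hq hq0]
  positivity

theorem hauptmodul_add_five_ne_zero {q : ℂ} (hq : ‖q‖ < 1) (hq0 : q ≠ 0) :
    hauptmodul q + 5 ≠ 0 := by
  have h1 : eulerF 1 q ≠ 0 := eulerF_ne_zero hq one_ne_zero
  have h2 : eulerF 2 q ≠ 0 := eulerF_ne_zero hq two_ne_zero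
  have h5 : eulerF 5 q ≠ 0 := eulerF_ne_zero hq (by norm_num)
  have h10 : eulerF 10 q ≠ 0 := eulerF_ne_zero hq (by norm_num)
  rw [hauptmodul_add_five hq hq0]
  positivity

/-- `t(q) t(-q) = -T² / (T + 4)` with `T = t(q²)`. -/
theorem hauptmodul_mul_neg {q : ℂ} (hq : ‖q‖ < 1) (hq0 : q ≠ 0) :
    hauptmodul q * hauptmodul (-q) = -hauptmodul (q ^ 2) ^ 2 / (hauptmodul (q ^ 2) + 4) := by
  have hQ := norm_pow_lt_one hq two_ne_zero
  rw [hauptmodul_add_four hQ (pow_ne_zero 2 hq0)]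
  have e1 := eulerF_one_neg hq
  have e5 := eulerF_five_neg hq
  have h1 : eulerF 1 q ≠ 0 := eulerF_ne_zero hq one_ne_zero
  have h2 : eulerF 2 q ≠ 0 := eulerF_ne_zero hq two_ne_zero
  have h4 : eulerF 4 q ≠ 0 := eulerF_ne_zero hq (by norm_num)
  have h5 : eulerF 5 q ≠ 0 := eulerF_ne_zero hq (by norm_num)
  have h10 : eulerF 10 q ≠ 0 := eulerF_ne_zero hq (by norm_num)
  have h20 : eulerF 20 q ≠ 0 := eulerF_ne_zero hq (by norm_num)
  have n1 : eulerF 1 (-q) = eulerF 2 q ^ 3 / (eulerF 1 q * eulerF 4 q) := by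
    rw [eq_div_iff (mul_ne_zero h1 h4), ← e1]; ring
  have n5 : eulerF 5 (-q) = eulerF 10 q ^ 3 / (eulerF 5 q * eulerF 20 q) := by
    rw [eq_div_iff (mul_ne_zero h5 h20), ← e5]; ring
  unfold hauptmodul
  simp only [eulerF_pow, Nat.reduceMul]
  rw [n1, n5, eulerF_neg_of_even (by decide : Even 2), eulerF_neg_of_even (by decide : Even 10)]
  field_simp

/-- `(t(q) + 4) (t(-q) + 4) = -(T + 4)` with `T = t(q²)`. -/
theorem hauptmodul_add_four_mul_neg {q : ℂ} (hq : ‖q‖ < 1) (hq0 : q ≠ 0) :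
    (hauptmodul q + 4) * (hauptmodul (-q) + 4) = -(hauptmodul (q ^ 2) + 4) := by
  have hq' : ‖-q‖ < 1 := by rwa [norm_neg]
  have hQ := norm_pow_lt_one hq two_ne_zero
  rw [hauptmodul_add_four hQ (pow_ne_zero 2 hq0), hauptmodul_add_four hq hq0,
    hauptmodul_add_four hq' (neg_ne_zero.mpr hq0)]
  have e1 := eulerF_one_neg hq
  have e5 := eulerF_five_neg hq
  have h1 : eulerF 1 q ≠ 0 := eulerF_ne_zero hq one_ne_zero
  have h2 : eulerF 2 q ≠ 0 := eulerF_ne_zero hq two_ne_zero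
  have h4 : eulerF 4 q ≠ 0 := eulerF_ne_zero hq (by norm_num)
  have h5 : eulerF 5 q ≠ 0 := eulerF_ne_zero hq (by norm_num)
  have h10 : eulerF 10 q ≠ 0 := eulerF_ne_zero hq (by norm_num)
  have h20 : eulerF 20 q ≠ 0 := eulerF_ne_zero hq (by norm_num)
  have n1 : eulerF 1 (-q) = eulerF 2 q ^ 3 / (eulerF 1 q * eulerF 4 q) := by
    rw [eq_div_iff (mul_ne_zero h1 h4), ← e1]; ring
  have n5 : eulerF 5 (-q) = eulerF 10 q ^ 3 / (eulerF 5 q * eulerF 20 q) := by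
    rw [eq_div_iff (mul_ne_zero h5 h20), ← e5]; ring
  simp only [eulerF_pow, Nat.reduceMul]
  rw [n1, n5, eulerF_neg_of_even (by decide : Even 2), eulerF_neg_of_even (by decide : Even 10)]
  field_simp

/-- `t(q) + t(-q) = -(6 T + 20) / (T + 4)` with `T = t(q²)`. -/
theorem hauptmodul_add_neg {q : ℂ} (hq : ‖q‖ < 1) (hq0 : q ≠ 0) :
    hauptmodul q + hauptmodul (-q) =
      -(6 * hauptmodul (q ^ 2) + 20) / (hauptmodul (q ^ 2) + 4) := by
  have h4 := hauptmodul_add_four_ne_zero (norm_pow_lt_one hq two_ne_zero) (pow_ne_zero 2 hq0)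
  have hm := hauptmodul_mul_neg hq hq0
  have ha := hauptmodul_add_four_mul_neg hq hq0
  rw [eq_div_iff h4] at hm ⊢
  linear_combination ((hauptmodul (q ^ 2) + 4) / 4) * ha - hm / 4

/-! ### The operator `U₂` on four products of weight four -/

/-- `q f₁⁴ f₅⁴`. -/
noncomputable def formF (q : ℂ) : ℂ := q * (eulerF 1 q ^ 4 * eulerF 5 q ^ 4)

/-- `q² f₂⁴ f₁₀⁴`. -/
noncomputable def formG (q : ℂ) : ℂ := q ^ 2 * (eulerF 2 q ^ 4 * eulerF 10 q ^ 4)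

/-- `q² f₁ f₂ f₅³ f₁₀³`. -/
noncomputable def formH (q : ℂ) : ℂ :=
  q ^ 2 * (eulerF 1 q * eulerF 2 q * eulerF 5 q ^ 3 * eulerF 10 q ^ 3)

/-- `q f₂⁵ f₅⁵ / (f₁ f₁₀)`. -/
noncomputable def formM (q : ℂ) : ℂ :=
  q * (eulerF 2 q ^ 5 * eulerF 5 q ^ 5 / (eulerF 1 q * eulerF 10 q))

/-- `q² f₁⁵ f₁₀⁵ / (f₂ f₅)`. -/
noncomputable def formT (q : ℂ) : ℂ :=
  q ^ 2 * (eulerF 1 q ^ 5 * eulerF 10 q ^ 5 / (eulerF 2 q * eulerF 5 q))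

theorem formG_eq (q : ℂ) : formG q = formF (q ^ 2) := by
  simp only [formG, formF, eulerF_pow, Nat.reduceMul]

theorem formG_neg (q : ℂ) : formG (-q) = formG q := by
  rw [formG_eq, formG_eq, neg_sq]

theorem formF_eq {q : ℂ} (hq : ‖q‖ < 1) (hq0 : q ≠ 0) :
    formF q = formG q * (hauptmodul q * (hauptmodul q + 4) / (hauptmodul q + 5)) := by
  have h1 : eulerF 1 q ≠ 0 := eulerF_ne_zero hq one_ne_zero
  have h2 : eulerF 2 q ≠ 0 := eulerF_ne_zero hq two_ne_zero
  have h5 : eulerF 5 q ≠ 0 := eulerF_ne_zero hq (by norm_num)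
  have h10 : eulerF 10 q ≠ 0 := eulerF_ne_zero hq (by norm_num)
  rw [hauptmodul_add_four hq hq0, hauptmodul_add_five hq hq0]
  unfold hauptmodul formF formG
  field_simp

theorem formM_eq {q : ℂ} (hq : ‖q‖ < 1) (hq0 : q ≠ 0) :
    formM q = formG q * (hauptmodul q + 4) := by
  have h1 : eulerF 1 q ≠ 0 := eulerF_ne_zero hq one_ne_zero
  have h2 : eulerF 2 q ≠ 0 := eulerF_ne_zero hq two_ne_zero
  have h5 : eulerF 5 q ≠ 0 := eulerF_ne_zero hq (by norm_num)
  have h10 : eulerF 10 q ≠ 0 := eulerF_ne_zero hq (by norm_num)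
  rw [hauptmodul_add_four hq hq0]
  unfold formM formG
  field_simp

theorem formT_eq {q : ℂ} (hq : ‖q‖ < 1) (hq0 : q ≠ 0) :
    formT q = formG q * (hauptmodul q / (hauptmodul q + 5)) := by
  have h1 : eulerF 1 q ≠ 0 := eulerF_ne_zero hq one_ne_zero
  have h2 : eulerF 2 q ≠ 0 := eulerF_ne_zero hq two_ne_zero
  have h5 : eulerF 5 q ≠ 0 := eulerF_ne_zero hq (by norm_num)
  have h10 : eulerF 10 q ≠ 0 := eulerF_ne_zero hq (by norm_num)
  rw [hauptmodul_add_five hq hq0]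
  unfold hauptmodul formT formG
  field_simp

/-- `H` in terms of the Hauptmodul. The middle factor is `q² f₁₀⁶ / f₂⁶`, a function of `q²`. -/
theorem formH_eq {q : ℂ} (hq : ‖q‖ < 1) (hq0 : q ≠ 0) :
    formH q = formG q * ((hauptmodul (q ^ 2) + 4) ^ 2 /
      (hauptmodul (q ^ 2) ^ 2 * (hauptmodul (q ^ 2) + 5))) *
        (hauptmodul q * (hauptmodul q + 5)) := by
  have hQ := norm_pow_lt_one hq two_ne_zero
  have hQ0 := pow_ne_zero 2 hq0
  have h1 : eulerF 1 q ≠ 0 := eulerF_ne_zero hq one_ne_zero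
  have h2 : eulerF 2 q ≠ 0 := eulerF_ne_zero hq two_ne_zero
  have h4 : eulerF 4 q ≠ 0 := eulerF_ne_zero hq (by norm_num)
  have h5 : eulerF 5 q ≠ 0 := eulerF_ne_zero hq (by norm_num)
  have h10 : eulerF 10 q ≠ 0 := eulerF_ne_zero hq (by norm_num)
  have h20 : eulerF 20 q ≠ 0 := eulerF_ne_zero hq (by norm_num)
  rw [hauptmodul_add_five hq hq0, hauptmodul_add_four hQ hQ0, hauptmodul_add_five hQ hQ0]
  unfold hauptmodul formH formG
  simp only [eulerF_pow, Nat.reduceMul]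
  field_simp

theorem formG_sq_eq {q : ℂ} (hq : ‖q‖ < 1) (hq0 : q ≠ 0) :
    formG (q ^ 2) = formG q * ((hauptmodul (q ^ 2) + 5) /
      (hauptmodul (q ^ 2) * (hauptmodul (q ^ 2) + 4))) := by
  have hQ := norm_pow_lt_one hq two_ne_zero
  have hQ0 := pow_ne_zero 2 hq0
  have h1 : eulerF 1 q ≠ 0 := eulerF_ne_zero hq one_ne_zero
  have h2 : eulerF 2 q ≠ 0 := eulerF_ne_zero hq two_ne_zero
  have h4 : eulerF 4 q ≠ 0 := eulerF_ne_zero hq (by norm_num)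
  have h5 : eulerF 5 q ≠ 0 := eulerF_ne_zero hq (by norm_num)
  have h10 : eulerF 10 q ≠ 0 := eulerF_ne_zero hq (by norm_num)
  have h20 : eulerF 20 q ≠ 0 := eulerF_ne_zero hq (by norm_num)
  rw [hauptmodul_add_four hQ hQ0, hauptmodul_add_five hQ hQ0]
  unfold hauptmodul formG
  simp only [eulerF_pow, Nat.reduceMul]
  field_simp

theorem formH_sq_eq {q : ℂ} (hq : ‖q‖ < 1) (hq0 : q ≠ 0) :
    formH (q ^ 2) = formG q * (1 / hauptmodul (q ^ 2)) := by
  have h2 : eulerF 2 q ≠ 0 := eulerF_ne_zero hq two_ne_zero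
  have h4 : eulerF 4 q ≠ 0 := eulerF_ne_zero hq (by norm_num)
  have h5 : eulerF 5 q ≠ 0 := eulerF_ne_zero hq (by norm_num)
  have h10 : eulerF 10 q ≠ 0 := eulerF_ne_zero hq (by norm_num)
  have h20 : eulerF 20 q ≠ 0 := eulerF_ne_zero hq (by norm_num)
  unfold hauptmodul formH formG
  simp only [eulerF_pow, Nat.reduceMul]
  field_simp

/-- `(t(q) + 5) (t(-q) + 5) = -T (T + 5) / (T + 4)` with `T = t(q²)`. -/
theorem hauptmodul_add_five_mul_neg {q : ℂ} (hq : ‖q‖ < 1) (hq0 : q ≠ 0) :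
    (hauptmodul q + 5) * (hauptmodul (-q) + 5) =
      -(hauptmodul (q ^ 2) * (hauptmodul (q ^ 2) + 5)) / (hauptmodul (q ^ 2) + 4) := by
  have h4 := hauptmodul_add_four_ne_zero (norm_pow_lt_one hq two_ne_zero) (pow_ne_zero 2 hq0)
  have hm := hauptmodul_mul_neg hq hq0
  have ha := hauptmodul_add_neg hq hq0
  rw [eq_div_iff h4] at hm ha ⊢
  linear_combination hm + 5 * ha

/-- `U₂(F) = -4 F - 8 G`, in the form `f(q) + f(-q) = 2 (U₂ f)(q²)`. -/
theorem formF_add_neg {q : ℂ} (hq : ‖q‖ < 1) :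
    formF q + formF (-q) = 2 * (-4 * formF (q ^ 2) - 8 * formG (q ^ 2)) := by
  rcases eq_or_ne q 0 with rfl | hq0
  · simp [formF, formG]
  have hq' : ‖-q‖ < 1 := by rwa [norm_neg]
  have hQ := norm_pow_lt_one hq two_ne_zero
  have hn0 := neg_ne_zero.mpr hq0
  have hQ0 := pow_ne_zero 2 hq0
  rw [formF_eq hq hq0, formF_eq hq' hn0, formG_neg, ← formG_eq, formG_sq_eq hq hq0]
  have hT := hauptmodul_ne_zero hQ hQ0
  have hT4 := hauptmodul_add_four_ne_zero hQ hQ0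
  have hT5 := hauptmodul_add_five_ne_zero hQ hQ0
  have h5 := hauptmodul_add_five_ne_zero hq hq0
  have h5' := hauptmodul_add_five_ne_zero hq' hn0
  have hm := hauptmodul_mul_neg hq hq0
  have ha := hauptmodul_add_neg hq hq0
  have hm5 := hauptmodul_add_five_mul_neg hq hq0
  generalize hauptmodul q = t at *
  generalize hauptmodul (-q) = u at *
  generalize hauptmodul (q ^ 2) = T at *
  have key : t * (t + 4) / (t + 5) + u * (u + 4) / (u + 5) =
      (t * u * (t + u) + 5 * (t + u) ^ 2 - 2 * (t * u) + 20 * (t + u)) / ((t + 5) * (u + 5)) := by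
    field_simp
    ring
  rw [← mul_add, key, hm, ha, hm5]
  field_simp
  ring

/-- `U₂(H) = F + 2 H`, in the form `f(q) + f(-q) = 2 (U₂ f)(q²)`. -/
theorem formH_add_neg {q : ℂ} (hq : ‖q‖ < 1) :
    formH q + formH (-q) = 2 * (formF (q ^ 2) + 2 * formH (q ^ 2)) := by
  rcases eq_or_ne q 0 with rfl | hq0
  · simp [formF, formH]
  have hq' : ‖-q‖ < 1 := by rwa [norm_neg]
  have hQ := norm_pow_lt_one hq two_ne_zero
  have hn0 := neg_ne_zero.mpr hq0
  have hQ0 := pow_ne_zero 2 hq0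
  rw [formH_eq hq hq0, formH_eq hq' hn0, formG_neg, ← formG_eq, formH_sq_eq hq hq0, neg_sq]
  have hT := hauptmodul_ne_zero hQ hQ0
  have hT4 := hauptmodul_add_four_ne_zero hQ hQ0
  have hT5 := hauptmodul_add_five_ne_zero hQ hQ0
  have hm := hauptmodul_mul_neg hq hq0
  have ha := hauptmodul_add_neg hq hq0
  generalize hauptmodul q = t at *
  generalize hauptmodul (-q) = u at *
  generalize hauptmodul (q ^ 2) = T at *
  have key : t * (t + 5) + u * (u + 5) = (t + u) ^ 2 - 2 * (t * u) + 5 * (t + u) := by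
    ring
  rw [← mul_add, key, hm, ha]
  field_simp
  ring

/-- The even part of `q f₂⁵ f₅⁵ / (f₁ f₁₀)`. -/
theorem formM_add_neg {q : ℂ} (hq : ‖q‖ < 1) :
    formM q + formM (-q) = 2 * (formF (q ^ 2) - 8 * formG (q ^ 2) + 10 * formH (q ^ 2)) := by
  rcases eq_or_ne q 0 with rfl | hq0
  · simp [formF, formG, formH, formM]
  have hq' : ‖-q‖ < 1 := by rwa [norm_neg]
  have hQ := norm_pow_lt_one hq two_ne_zero
  have hn0 := neg_ne_zero.mpr hq0
  have hQ0 := pow_ne_zero 2 hq0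
  rw [formM_eq hq hq0, formM_eq hq' hn0, formG_neg, ← formG_eq, formG_sq_eq hq hq0,
    formH_sq_eq hq hq0]
  have hT := hauptmodul_ne_zero hQ hQ0
  have hT4 := hauptmodul_add_four_ne_zero hQ hQ0
  have ha := hauptmodul_add_neg hq hq0
  generalize hauptmodul q = t at *
  generalize hauptmodul (-q) = u at *
  generalize hauptmodul (q ^ 2) = T at *
  have key : t + 4 + (u + 4) = t + u + 8 := by
    ring
  rw [← mul_add, key, ha]
  field_simp
  ring

/-- The even part of `q² f₁⁵ f₁₀⁵ / (f₂ f₅)`. -/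
theorem formT_add_neg {q : ℂ} (hq : ‖q‖ < 1) :
    formT q + formT (-q) = 2 * (formF (q ^ 2) + 10 * formH (q ^ 2)) := by
  rcases eq_or_ne q 0 with rfl | hq0
  · simp [formF, formH, formT]
  have hq' : ‖-q‖ < 1 := by rwa [norm_neg]
  have hQ := norm_pow_lt_one hq two_ne_zero
  have hn0 := neg_ne_zero.mpr hq0
  have hQ0 := pow_ne_zero 2 hq0
  rw [formT_eq hq hq0, formT_eq hq' hn0, formG_neg, ← formG_eq, formH_sq_eq hq hq0]
  have hT := hauptmodul_ne_zero hQ hQ0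
  have hT4 := hauptmodul_add_four_ne_zero hQ hQ0
  have hT5 := hauptmodul_add_five_ne_zero hQ hQ0
  have h5 := hauptmodul_add_five_ne_zero hq hq0
  have h5' := hauptmodul_add_five_ne_zero hq' hn0
  have hm := hauptmodul_mul_neg hq hq0
  have ha := hauptmodul_add_neg hq hq0
  have hm5 := hauptmodul_add_five_mul_neg hq hq0
  generalize hauptmodul q = t at *
  generalize hauptmodul (-q) = u at *
  generalize hauptmodul (q ^ 2) = T at *
  have key : t / (t + 5) + u / (u + 5) =
      (2 * (t * u) + 5 * (t + u)) / ((t + 5) * (u + 5)) := by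
    field_simp
    ring
  rw [← mul_add, key, hm, ha, hm5]
  field_simp
  ring

/-! ### Power series on the unit disc -/

/-- The power series with coefficients `a` converges to `f` on the open unit disc. -/
def SumsOnDisc (a : ℕ → ℂ) (f : ℂ → ℂ) : Prop :=
  ∀ q : ℂ, ‖q‖ < 1 → HasSum (fun n => a n * q ^ n) (f q)

/-- The coefficients of an integral power series, as complex numbers. -/
noncomputable def complexCoeff (P : PowerSeries ℤ) (n : ℕ) : ℂ := ((PowerSeries.coeff n P : ℤ) : ℂ)

namespace SumsOnDisc

theorem congr {a : ℕ → ℂ} {f g : ℂ → ℂ} (h : SumsOnDisc a f)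
    (hfg : ∀ q : ℂ, ‖q‖ < 1 → f q = g q) : SumsOnDisc a g :=
  fun q hq => hfg q hq ▸ h q hq

theorem convolution {a b : ℕ → ℂ} {f g : ℂ → ℂ} (ha : SumsOnDisc a f) (hb : SumsOnDisc b g) :
    SumsOnDisc (fun n => ∑ p ∈ Finset.HasAntidiagonal.antidiagonal n, a p.1 * b p.2)
      (fun q => f q * g q) := by
  intro q hq
  have h1 := (ha q hq).summable.norm
  have h2 := (hb q hq).summable.norm
  have h3 := (summable_norm_sum_mul_antidiagonal_of_summable_norm h1 h2).of_norm.hasSum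
  rw [← tsum_mul_tsum_eq_tsum_sum_antidiagonal_of_summable_norm h1 h2, (ha q hq).tsum_eq,
    (hb q hq).tsum_eq] at h3
  refine h3.congr_fun fun n => ?_
  rw [Finset.sum_mul]
  refine Finset.sum_congr rfl fun p hp => ?_
  rw [← Finset.HasAntidiagonal.mem_antidiagonal.mp hp]
  ring

theorem mul {P Q : PowerSeries ℤ} {f g : ℂ → ℂ} (hP : SumsOnDisc (complexCoeff P) f)
    (hQ : SumsOnDisc (complexCoeff Q) g) :
    SumsOnDisc (complexCoeff (P * Q)) (fun q => f q * g q) := by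
  convert hP.convolution hQ using 1
  funext n
  simp [complexCoeff, PowerSeries.coeff_mul]

theorem one : SumsOnDisc (complexCoeff 1) fun _ => 1 := by
  intro q _
  convert hasSum_single (f := fun n => complexCoeff 1 n * q ^ n) 0 fun n hn => ?_ using 1
  · simp [complexCoeff]
  · simp [complexCoeff, PowerSeries.coeff_one, hn]

theorem X : SumsOnDisc (complexCoeff PowerSeries.X) fun q => q := by
  intro q _
  convert hasSum_single (f := fun n => complexCoeff PowerSeries.X n * q ^ n) 1 fun n hn => ?_
    using 1
  · simp [complexCoeff]
  · simp [complexCoeff, PowerSeries.coeff_X, hn]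

theorem pow {P : PowerSeries ℤ} {f : ℂ → ℂ} (hP : SumsOnDisc (complexCoeff P) f) (k : ℕ) :
    SumsOnDisc (complexCoeff (P ^ k)) (fun q => f q ^ k) := by
  induction k with
  | zero => simpa using one
  | succ k ih => simpa only [pow_succ] using ih.mul hP

theorem hasFPowerSeriesAt {a : ℕ → ℂ} {f : ℂ → ℂ} (ha : SumsOnDisc a f) :
    HasFPowerSeriesAt f (FormalMultilinearSeries.ofScalars ℂ a) 0 := by
  rw [hasFPowerSeriesAt_iff]
  filter_upwards [Metric.ball_mem_nhds (0 : ℂ) one_pos] with z hz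
  simpa [mul_comm] using ha z (by simpa using hz)

theorem unique {a b : ℕ → ℂ} {f : ℂ → ℂ} (ha : SumsOnDisc a f) (hb : SumsOnDisc b f) : a = b := by
  have h := ha.hasFPowerSeriesAt.eq_formalMultilinearSeries hb.hasFPowerSeriesAt
  funext n
  rw [← FormalMultilinearSeries.coeff_ofScalars (p := a), h,
    FormalMultilinearSeries.coeff_ofScalars]

theorem exists_of_differentiableOn {f : ℂ → ℂ} (hf : DifferentiableOn ℂ f (Metric.ball 0 1)) :
    ∃ a, SumsOnDisc a f := by
  refine ⟨fun n => (n.factorial : ℂ)⁻¹ * iteratedDeriv n f 0, fun q hq => ?_⟩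
  refine (Complex.hasSum_taylorSeries_on_ball hf (by simpa using hq)).congr_fun fun n => ?_
  simp only [smul_eq_mul, sub_zero]
  ring

/-- A formal quotient of power series converging on the unit disc, with a denominator without
zeros, converges on the unit disc to the quotient of the sums: the Taylor series of the quotient
solves the same equation. -/
theorem div {P Q R : PowerSeries ℤ} {f g : ℂ → ℂ} (hf : DifferentiableOn ℂ f (Metric.ball 0 1))
    (hg : DifferentiableOn ℂ g (Metric.ball 0 1)) (hg0 : ∀ q : ℂ, ‖q‖ < 1 → g q ≠ 0)
    (hP : SumsOnDisc (complexCoeff P) f) (hQ : SumsOnDisc (complexCoeff Q) g) (hQ0 : Q ≠ 0)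
    (hR : R * Q = P) : SumsOnDisc (complexCoeff R) (fun q => f q / g q) := by
  obtain ⟨a, ha⟩ := exists_of_differentiableOn
    (hf.fun_div hg fun q hq => hg0 q (by simpa using hq))
  have h := ((ha.convolution hQ).congr fun q hq => div_mul_cancel₀ _ (hg0 q hq)).unique hP
  have hmap : ∀ S : PowerSeries ℤ, PowerSeries.mk (complexCoeff S) =
      PowerSeries.map (Int.castRingHom ℂ) S := by
    intro S
    ext n
    simp [complexCoeff]
  have hQm : PowerSeries.map (Int.castRingHom ℂ) Q ≠ 0 := by
    intro h0
    refine hQ0 (PowerSeries.map_injective (Int.castRingHom ℂ) Int.cast_injective ?_)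
    rw [h0, map_zero]
  have ha' : PowerSeries.mk a = PowerSeries.map (Int.castRingHom ℂ) R := by
    refine mul_right_cancel₀ hQm ?_
    rw [← map_mul, hR, ← hmap, ← hmap, ← h]
    ext n
    simp [PowerSeries.coeff_mul]
  rw [← hmap] at ha'
  have : complexCoeff R = a := by
    funext n
    have := congrArg (PowerSeries.coeff n) ha'
    simpa using this.symm
  rwa [this]

/-- The coefficients of even index sum to the even part. -/
theorem even_part {a : ℕ → ℂ} {f g : ℂ → ℂ} (ha : SumsOnDisc a f)
    (hfg : ∀ q : ℂ, ‖q‖ < 1 → f q + f (-q) = 2 * g (q ^ 2)) :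
    SumsOnDisc (fun n => a (2 * n)) g := by
  intro q hq
  obtain ⟨s, rfl⟩ := IsAlgClosed.exists_pow_nat_eq q two_pos
  have hs : ‖s‖ < 1 := by
    by_contra h
    rw [norm_pow] at hq
    exact absurd hq (not_lt.mpr (one_le_pow₀ (not_lt.mp h)))
  have h := (ha s hs).add (ha (-s) (by rwa [norm_neg]))
  rw [hfg s hs] at h
  have hinj : Function.Injective fun n : ℕ => 2 * n := mul_right_injective₀ two_ne_zero
  rw [← hinj.hasSum_iff] at h
  · have h2 := h.mul_left (2⁻¹ : ℂ)
    rw [inv_mul_cancel_left₀ two_ne_zero] at h2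
    refine h2.congr_fun fun n => ?_
    simp only [Function.comp]
    rw [(even_two_mul n).neg_pow, pow_mul]
    ring
  · intro n hn
    have hodd : Odd n := by
      rw [← Nat.not_even_iff_odd]
      rintro ⟨m, rfl⟩
      exact hn ⟨m, by ring⟩
    rw [hodd.neg_pow]
    ring

end SumsOnDisc

/-! ### The formal Euler products converge on the unit disc -/

/-- The coefficients of a finite Euler product are bounded, uniformly in the number of factors, by
a multiple of `r ^ (-n)`, for every `r < 1`. -/
theorem abs_coeff_partialProd_le (m : ℕ) {r : ℝ} (hr : 0 ≤ r) (N n : ℕ) :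
    |((PowerSeries.coeff n (∏ i ∈ Finset.range N,
      (1 - PowerSeries.X ^ (m * (i + 1)) : PowerSeries ℤ)) : ℤ) : ℝ)| * r ^ n ≤
      ∏ i ∈ Finset.range N, (1 + r ^ (m * (i + 1))) := by
  induction N generalizing n with
  | zero =>
    rcases eq_or_ne n 0 with rfl | hn
    · simp
    · simp [PowerSeries.coeff_one, hn]
  | succ N ih =>
    rw [Finset.prod_range_succ, Finset.prod_range_succ, mul_sub, mul_one, map_sub,
      PowerSeries.coeff_mul_X_pow']
    set d := m * (N + 1)
    set B := ∏ i ∈ Finset.range N, (1 + r ^ (m * (i + 1)))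
    have hB : 0 ≤ B := Finset.prod_nonneg fun _ _ => by positivity
    rw [mul_add, mul_one]
    have h1 := ih n
    split_ifs with hd
    · have h2 := mul_le_mul_of_nonneg_right (ih (n - d)) (pow_nonneg hr d)
      rw [mul_assoc, ← pow_add, Nat.sub_add_cancel hd] at h2
      push_cast
      refine (mul_le_mul_of_nonneg_right (abs_sub _ _) (pow_nonneg hr n)).trans ?_
      rw [add_mul]
      exact add_le_add h1 h2
    · rw [sub_zero]
      exact h1.trans (le_add_of_nonneg_right (mul_nonneg hB (pow_nonneg hr d)))

theorem sumsOnDisc_partialProd (m N : ℕ) :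
    SumsOnDisc (complexCoeff (∏ i ∈ Finset.range N, (1 - PowerSeries.X ^ (m * (i + 1)))))
      (fun q => ∏ i ∈ Finset.range N, (1 - q ^ (m * (i + 1)))) := by
  induction N with
  | zero => simpa using SumsOnDisc.one
  | succ N ih =>
    simp_rw [Finset.prod_range_succ]
    refine ih.mul ?_
    intro q hq
    refine ((SumsOnDisc.one q hq).sub (SumsOnDisc.X.pow (m * (N + 1)) q hq)).congr_fun fun n => ?_
    simp [complexCoeff, sub_mul]

theorem sumsOnDisc_formalF {m : ℕ} (hm : m ≠ 0) :
    SumsOnDisc (complexCoeff (formalF m)) (eulerF m) := by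
  intro q hq
  -- the coefficients are `O(r ^ (-n))` uniformly in the finite products, for some `r > ‖q‖`
  obtain ⟨r, hqr, hr1⟩ := exists_between hq
  have hr0 : 0 < r := (norm_nonneg q).trans_lt hqr
  obtain ⟨C, hC⟩ : ∃ C, ∀ N, ∏ i ∈ Finset.range N, (1 + r ^ (m * (i + 1))) ≤ C := by
    have hs : Summable fun i : ℕ => ‖r ^ (m * (i + 1))‖ := by
      have := summable_norm_pow_mul_add (q := (r : ℂ))
        (by rwa [Complex.norm_real, Real.norm_of_nonneg hr0.le]) hm m
      simpa [mul_add] using this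
    obtain ⟨C, hC⟩ :=
      (multipliable_one_add_of_summable hs).tendsto_prod_tprod_nat.bddAbove_range
    exact ⟨C, fun N => hC ⟨N, rfl⟩⟩
  have hcoeff : ∀ n, Tendsto (fun N => complexCoeff (∏ i ∈ Finset.range N,
      (1 - PowerSeries.X ^ (m * (i + 1)))) n) atTop (𝓝 (complexCoeff (formalF m) n)) := by
    intro n
    have h := (formalF_multipliable m (Nat.one_le_iff_ne_zero.mpr hm)).tendsto_prod_tprod_nat
    have h2 := ((PowerSeries.WithPiTopology.continuous_coeff ℤ n).tendsto _).comp h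
    exact ((continuous_of_discreteTopology (f := fun z : ℤ => (z : ℂ))).tendsto _).comp h2
  have hbound : ∀ N n, ‖complexCoeff (∏ i ∈ Finset.range N,
      (1 - PowerSeries.X ^ (m * (i + 1)))) n * q ^ n‖ ≤ C * (‖q‖ / r) ^ n := by
    intro N n
    have h := (abs_coeff_partialProd_le m hr0.le N n).trans (hC N)
    rw [complexCoeff, norm_mul, norm_pow, Complex.norm_intCast, div_pow, mul_div_assoc',
      le_div_iff₀ (pow_pos hr0 n), mul_right_comm]
    exact mul_le_mul_of_nonneg_right h (by positivity)
  have hgeo : Summable fun n : ℕ => C * (‖q‖ / r) ^ n :=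
    (summable_geometric_of_lt_one (by positivity) ((div_lt_one hr0).mpr hqr)).mul_left C
  have hlim := tendsto_tsum_of_dominated_convergence hgeo
    (fun n => (hcoeff n).mul_const (q ^ n)) (Eventually.of_forall hbound)
  simp_rw [(sumsOnDisc_partialProd m _ q hq).tsum_eq] at hlim
  have hprod : Tendsto (fun N => ∏ i ∈ Finset.range N, (1 - q ^ (m * (i + 1)))) atTop
      (𝓝 (eulerF m q)) := by
    have := multipliable_one_sub_pow hq hm m
    exact Multipliable.tendsto_prod_tprod_nat (by simpa only [mul_add, mul_one] using this)
  rw [tendsto_nhds_unique hprod hlim]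
  refine (Summable.of_norm_bounded hgeo fun n => ?_).hasSum
  exact le_of_tendsto ((hcoeff n).mul_const (q ^ n)).norm (Eventually.of_forall fun N => hbound N n)

theorem differentiableOn_eulerF {m : ℕ} (hm : m ≠ 0) :
    DifferentiableOn ℂ (eulerF m : ℂ → ℂ) (Metric.ball 0 1) := by
  have h : DifferentiableOn ℂ (fun q : ℂ => eulerF 1 (q ^ m)) (Metric.ball 0 1) := by
    refine DifferentiableOn.comp (g := eulerF 1) (f := fun q : ℂ => q ^ m)
      (t := Metric.ball 0 1) ?_ (by fun_prop) fun q hq => ?_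
    · exact ModularForm.differentiableOn_tprod_one_sub_pow.congr fun q _ => by
        simp only [eulerF, one_mul]
    · simp only [mem_ball_zero_iff] at hq ⊢
      exact norm_pow_lt_one hq hm
  exact h.congr fun q _ => by rw [eulerF_pow, mul_one]

theorem formalF_ne_zero {m : ℕ} (hm : m ≠ 0) : formalF m ≠ 0 := by
  intro h
  have := constantCoeff_formalF m (Nat.one_le_iff_ne_zero.mpr hm)
  simp [h] at this

theorem sumsOnDisc_X_mul_genM :
    SumsOnDisc (complexCoeff (PowerSeries.X ^ 1 * genM)) formM := by
  have d := fun (m : ℕ) (hm : m ≠ 0) => differentiableOn_eulerF hm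
  have f := fun (m : ℕ) (hm : m ≠ 0) => sumsOnDisc_formalF hm
  have h := SumsOnDisc.div
    (((d 2 (by norm_num)).fun_pow 5).fun_mul ((d 5 (by norm_num)).fun_pow 5))
    ((d 1 (by norm_num)).fun_mul (d 10 (by norm_num)))
    (fun q hq => mul_ne_zero (eulerF_ne_zero hq (by norm_num)) (eulerF_ne_zero hq (by norm_num)))
    (((f 2 (by norm_num)).pow 5).mul ((f 5 (by norm_num)).pow 5))
    ((f 1 (by norm_num)).mul (f 10 (by norm_num)))
    (mul_ne_zero (formalF_ne_zero (by norm_num)) (formalF_ne_zero (by norm_num))) genM_mul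
  simpa only [pow_one] using! (SumsOnDisc.X.pow 1).mul h

theorem sumsOnDisc_X_sq_mul_genTstar :
    SumsOnDisc (complexCoeff (PowerSeries.X ^ 2 * genTstar)) formT := by
  have d := fun (m : ℕ) (hm : m ≠ 0) => differentiableOn_eulerF hm
  have f := fun (m : ℕ) (hm : m ≠ 0) => sumsOnDisc_formalF hm
  have h := SumsOnDisc.div
    (((d 1 (by norm_num)).fun_pow 5).fun_mul ((d 10 (by norm_num)).fun_pow 5))
    ((d 2 (by norm_num)).fun_mul (d 5 (by norm_num)))
    (fun q hq => mul_ne_zero (eulerF_ne_zero hq (by norm_num)) (eulerF_ne_zero hq (by norm_num)))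
    (((f 1 (by norm_num)).pow 5).mul ((f 10 (by norm_num)).pow 5))
    ((f 2 (by norm_num)).mul (f 5 (by norm_num)))
    (mul_ne_zero (formalF_ne_zero (by norm_num)) (formalF_ne_zero (by norm_num))) genTstar_mul
  exact (SumsOnDisc.X.pow 2).mul h

theorem sumsOnDisc_X_mul_genPstar :
    SumsOnDisc (complexCoeff (PowerSeries.X ^ 1 * genPstar)) formF := by
  have h := ((sumsOnDisc_formalF one_ne_zero).pow 4).mul
    ((sumsOnDisc_formalF (m := 5) (by norm_num)).pow 4)
  simpa only [pow_one] using! (SumsOnDisc.X.pow 1).mul h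

/-! ### Iterated dissection -/

/-- One application of `U₂` to a combination of `F`, `G` and `H`. -/
theorem SumsOnDisc.even_part_comb {a : ℕ → ℂ} {x y z : ℂ}
    (h : SumsOnDisc a fun q => x * formF q + y * formG q + z * formH q) :
    SumsOnDisc (fun n => a (2 * n)) fun q =>
      (-4 * x + y + z) * formF q + (-8 * x) * formG q + (2 * z) * formH q := by
  refine h.even_part fun q hq => ?_
  have hG := formG_eq q
  rw [formG_neg]
  linear_combination x * formF_add_neg hq + z * formH_add_neg hq + 2 * y * hG

theorem sumsOnDisc_genM (k : ℕ) :
    SumsOnDisc (fun n => complexCoeff (PowerSeries.X ^ 1 * genM) (2 ^ (k + 1) * n)) fun q =>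
      seqA (k + 1) * formF q + (-8 * seqA k) * formG q + (5 * 2 ^ (k + 1)) * formH q := by
  induction k with
  | zero =>
    simp only [zero_add, pow_one (2 : ℕ)]
    refine sumsOnDisc_X_mul_genM.even_part fun q hq => ?_
    rw [formM_add_neg hq]
    simp only [seqA]
    push_cast
    ring
  | succ k ih =>
    have h := ih.even_part_comb
    simp only [← mul_assoc, ← pow_succ] at h
    refine h.congr fun q _ => ?_
    simp only [seqA]
    push_cast
    ring

theorem sumsOnDisc_genTstar (k : ℕ) :
    SumsOnDisc (fun n => complexCoeff (PowerSeries.X ^ 2 * genTstar) (2 ^ (k + 1) * n)) fun q =>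
      seqB (k + 1) * formF q + (-8 * seqB k) * formG q + (5 * 2 ^ (k + 1)) * formH q := by
  induction k with
  | zero =>
    simp only [zero_add, pow_one (2 : ℕ)]
    refine sumsOnDisc_X_sq_mul_genTstar.even_part fun q hq => ?_
    rw [formT_add_neg hq]
    simp only [seqB]
    push_cast
    ring
  | succ k ih =>
    have h := ih.even_part_comb
    simp only [← mul_assoc, ← pow_succ] at h
    refine h.congr fun q _ => ?_
    simp only [seqB]
    push_cast
    ring

theorem sumsOnDisc_genPstar (k : ℕ) :
    SumsOnDisc (fun n => complexCoeff (PowerSeries.X ^ 1 * genPstar) (2 ^ (k + 1) * n)) fun q =>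
      seqC (k + 1) * formF q + (-8 * seqC k) * formG q + 0 * formH q := by
  induction k with
  | zero =>
    simp only [zero_add, pow_one (2 : ℕ)]
    refine sumsOnDisc_X_mul_genPstar.even_part fun q hq => ?_
    rw [formF_add_neg hq]
    simp only [seqC]
    push_cast
    ring
  | succ k ih =>
    have h := ih.even_part_comb
    simp only [← mul_assoc, ← pow_succ] at h
    refine h.congr fun q _ => ?_
    simp only [seqC]
    push_cast
    ring

/-- The integers `≥ -1`, enumerated by `n ↦ n - 1`. -/
def natEquivIciNegOne : ℕ ≃ Set.Ici (-1 : ℤ) where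
  toFun n := ⟨n - 1, by simp only [Set.mem_Ici]; omega⟩
  invFun m := (m.1 + 1).toNat
  left_inv n := by simp
  right_inv m := by
    have := m.2
    simp only [Set.mem_Ici] at this
    ext
    simp only
    omega

/-- Division by `q²` and reindexing by the integers `≥ -1`. -/
theorem SumsOnDisc.hasSum_Ici {P : PowerSeries ℤ} {r k : ℕ} (hr : r ≠ 0) (hrk : r ≤ 2 ^ k)
    {f : ℂ → ℂ}
    (h : SumsOnDisc (fun n => complexCoeff (PowerSeries.X ^ r * P) (2 ^ k * n)) f) {q : ℂ}
    (hq : ‖q‖ < 1) (hq0 : q ≠ 0) :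
    HasSum (fun n : Set.Ici (-1 : ℤ) =>
      ((PowerSeries.coeff (2 ^ k * (n : ℤ) + 2 ^ (k + 1) - r).toNat P : ℤ) : ℂ) * q ^ (n : ℤ))
      (f q / q ^ 2) := by
  rw [← natEquivIciNegOne.hasSum_iff]
  -- the term of index `0` vanishes, because `X ^ r * P` has no constant term
  have h0 := (hasSum_nat_add_iff' 1).mpr (h q hq)
  simp only [Finset.sum_range_one, complexCoeff, mul_zero, PowerSeries.coeff_X_pow_mul',
    Nat.le_zero, hr, if_false, Int.cast_zero, zero_mul, sub_zero] at h0
  refine (h0.div_const (q ^ 2)).congr_fun fun n => ?_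
  have hle : r ≤ 2 ^ k * (n + 1) := hrk.trans (Nat.le_mul_of_pos_right _ n.succ_pos)
  have hidx : (2 ^ k * ((n : ℤ) - 1) + 2 ^ (k + 1) - r).toNat = 2 ^ k * (n + 1) - r := by
    have : (2 ^ k * ((n : ℤ) - 1) + 2 ^ (k + 1) - r) = ((2 ^ k * (n + 1) - r : ℕ) : ℤ) := by
      rw [Nat.cast_sub hle]
      push_cast
      ring
    rw [this, Int.toNat_natCast]
  simp only [Function.comp, natEquivIciNegOne, Equiv.coe_fn_mk]
  rw [hidx, if_pos hle, zpow_sub_one₀ hq0, zpow_natCast]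
  field_simp
  ring

theorem theorem3p1 (k : ℕ) (hk : 1 ≤ k) (q : ℂ) (hq0 : q ≠ 0) (hq1 : ‖q‖ < 1) :
    HasSum
      (fun n : Set.Ici (-1 : ℤ) =>
        (partM (2 ^ k * (n : ℤ) + 2 ^ (k + 1) - 1).toNat : ℂ) * q ^ (n : ℤ))
      ((seqA k : ℂ) * (eulerF 1 q ^ 4 * eulerF 5 q ^ 4 / q)
        - 8 * (seqA (k - 1) : ℂ) * (eulerF 2 q ^ 4 * eulerF 10 q ^ 4)
        + 5 * 2 ^ k * (eulerF 1 q * eulerF 2 q * eulerF 5 q ^ 3 * eulerF 10 q ^ 3)) ∧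
    HasSum
      (fun n : Set.Ici (-1 : ℤ) =>
        (partTstar (2 ^ k * (n : ℤ) + 2 ^ (k + 1) - 2).toNat : ℂ) * q ^ (n : ℤ))
      ((seqB k : ℂ) * (eulerF 1 q ^ 4 * eulerF 5 q ^ 4 / q)
        - 8 * (seqB (k - 1) : ℂ) * (eulerF 2 q ^ 4 * eulerF 10 q ^ 4)
        + 5 * 2 ^ k * (eulerF 1 q * eulerF 2 q * eulerF 5 q ^ 3 * eulerF 10 q ^ 3)) ∧
    HasSum
      (fun n : Set.Ici (-1 : ℤ) =>
        (partPstar (2 ^ k * (n : ℤ) + 2 ^ (k + 1) - 1).toNat : ℂ) * q ^ (n : ℤ))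
      ((seqC k : ℂ) * (eulerF 1 q ^ 4 * eulerF 5 q ^ 4 / q)
        - 8 * (seqC (k - 1) : ℂ) * (eulerF 2 q ^ 4 * eulerF 10 q ^ 4)) := by
  obtain ⟨k, rfl⟩ : ∃ j, k = j + 1 := ⟨k - 1, by omega⟩
  have h2 : 2 ≤ 2 ^ (k + 1) := Nat.le_self_pow (Nat.succ_ne_zero k) 2
  rw [Nat.add_sub_cancel]
  refine ⟨?_, ?_, ?_⟩
  · convert (sumsOnDisc_genM k).hasSum_Ici one_ne_zero (one_le_two.trans h2) hq1 hq0 using 1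
    · rfl
    · simp only [formF, formG, formH]
      field_simp
      ring
  · convert (sumsOnDisc_genTstar k).hasSum_Ici two_ne_zero h2 hq1 hq0 using 1
    · rfl
    · simp only [formF, formG, formH]
      field_simp
      ring
  · convert (sumsOnDisc_genPstar k).hasSum_Ici one_ne_zero (one_le_two.trans h2) hq1 hq0 using 1
    · rfl
    · simp only [formF, formG, formH]
      field_simp
      ring
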